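/- **Fuzzy geometries.** Let $p,q\ge 0$ with $d=p+q$ even, and $g=\mathrm{diag}(+1,\dots,+1,-1,\dots,-1)$ ($p$ plus signs, $q$ minus signs). Let $V$ be a finite-dimensional irreducible Hermitian module of the Clifford algebra $\mathcal{C}\ell(p,q)$, with gamma matrices $\gamma^1,\dots,\gamma^d$, $\gamma^\mu\gamma^\nu+\gamma^\nu\gamma^\mu=2g^{\mu\nu}$, where $\gamma^\mu$ is Hermitian for $\mu\le p$ and anti-Hermitian for $\mu>p$. Let $\gamma=(-\mathrm i)^{s(s-1)/2}\gamma^1\cdots\gamma^d$ be the chirality, $s=q-p$, and for $s\equiv 0,2,4,6 \pmod 8$ let $(\epsilon,\epsilon',\epsilon'')=(+,+,+),(-,+,-),(-,+,+),(+,+,-)$ respectively. Let $C$ be an anti-unitary map of $V$ with $C^2=\epsilon$, $C\gamma^\mu=\epsilon'\gamma^\mu C$ and $C\gamma=\epsilon''\gamma C$. On the Hilbert space $\mathcal H=V\otimes M_N(\mathbb C)$, with $\langle v\otimes R,w\otimes S\rangle=(v,w)\,\mathrm{Tr}(R^*S)$, put $\rho(a)(v\otimes R)=v\otimes aR$ and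 $J(v\otimes R)=Cv\otimes R^*$. The Dirac operator $D$ of the fuzzy geometry is a self-adjoint operator on $\mathcal H$ with $[[D,\rho(a)],J\rho(b)J^{-1}]=0$ for all $a,b\in M_N(\mathbb C)$, $JD=\epsilon' DJ$, and $D(\gamma\otimes 1)=-(\gamma\otimes 1)D$. **Parametrization.** Let $\Lambda_d^-$ be the set of the $2^{d-1}$ increasing tuples $I=(\mu_1<\dots<\mu_r)$ in $\{1,\dots,d\}$ with $r$ odd; put $\Gamma^I=\gamma^{\mu_1}\cdots\gamma^{\mu_r}$ and $e_I=(-1)^{u(I)+\lfloor |I|/2\rfloor}$, where $u(I)$ is the number of indices of $I$ that are $>p$ (so $(\Gamma^I)^*=e_I\Gamma^I$). Matrices $K_I\in M_N(\mathbb C)$, $I\in\Lambda_d^-$, *parametrize* $D$ if $K_I^*=e_IK_I$ for all $I$ and $D=\sum_{I\in\Lambda_d^-}\Gamma^I\otimes k_I$, where $k_I(R)=K_IR+e_IRK_I$. **Functionals.** Write $\langle I_1\dots I_m\rangle=\frac1{\dim V}\mathrm{Tr}_V(\Gamma^{I_1}\cdots\Gamma^{I_m})$, let $\mathrm{Tr}_N$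 be the trace of $N\times N$ matrices, and for $m\ge 1$ $$\mathcal S_m=\sum_{I_1,\dots,I_m\in\Lambda_d^-}\langle I_1\dots I_m\rangle\big(\mathrm{Tr}_N(K_{I_1}\cdots K_{I_m})+e_{I_1}\cdots e_{I_m}\mathrm{Tr}_N(K_{I_m}\cdots K_{I_1})\big),$$ $$\mathcal B_m=\sum_{I_1,\dots,I_m\in\Lambda_d^-}\langle I_1\dots I_m\rangle\sum_{\emptyset\ne\Upsilon\subsetneq\{1,\dots,m\}}\Big(\prod_{j\in\Upsilon}e_{I_j}\Big)\,\mathrm{Tr}_N\Big(\prod_{j\notin\Upsilon}K_{I_j}\Big)\,\mathrm{Tr}_N\Big(\prod_{j\in\Upsilon}K_{I_j}^{T}\Big),$$ with products in increasing order of $j$. For a real polynomial $f(x)=\sum_{m\ge1}f_mx^m$ put $\mathcal S_f=\sum_m f_m\mathcal S_m$ and $\mathcal B_f=\sum_m f_m\mathcal B_m$. **Cyclic self-adjointness.** Let $z_I$, $I\in\Lambda_d^-$, be noncommuting variables with formal adjoints $z_I^*=e_Iz_I$. The monomials of $P\in\mathbb R\langle z_I\rangle$ are its words with nonzero coefficient,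 each taken together with its coefficient. $P$ is *cyclic self-adjoint* (resp. *cyclic anti-self-adjoint*) if there is a bijection $w\mapsto w'$ of the set of monomials of $P$ such that, for each $w$, $w^*$ equals $+$ (resp. $-$) some cyclic permutation of the letters of $w'$. **Statement.** Let $f$ be a real polynomial without constant term. Assume that either $p+q=2$ and $\deg f\le 6$, or $(p,q)\in\{(0,4),(1,3)\}$ (Riemannian, Lorentzian) and $\deg f\le 4$. Then there are finitely many noncommutative polynomials $P,\Phi_i,\Psi_i\in\mathbb R\langle z_I: I\in\Lambda_d^-\rangle$, depending only on $(p,q)$ and $f$, such that $P$ is cyclic self-adjoint and, for each $i$, $\Phi_i$ and $\Psi_i$ are either both cyclic self-adjoint or both cyclic anti-self-adjoint, and such that for every $N$ and every fuzzy geometry of signature $(p,q)$ as above the following holds: $D$ is parametrized by some matrices $(K_I)$, and for every $(K_I)$ that parametrizes $D$ $$\mathrm{Tr}_{\mathcal H} f(D)=\dim V\,(N\cdot\mathcal S_f+\mathcal B_f),\qquad \mathcal S_f=\mathrm{Tr}_N P(K),\qquad \mathcal B_f=\sum_i\mathrm{Tr}_N\Phi_i(K)\cdot\mathrm{Tr}_N\Psi_i(K),$$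 hence $\mathrm{Tr}_{\mathcal H} f(D)=\dim V\,\big(N\,\mathrm{Tr}_NP(K)+\sum_i\mathrm{Tr}_N\Phi_i(K)\,\mathrm{Tr}_N\Psi_i(K)\big)$. -/

import Mathlib

open scoped TensorProduct

noncomputable section

namespace FuzzyGeom

/-! ### Noncommutative polynomials with formally (anti-)self-adjoint variables

Throughout, `e x = 1` means that the variable `x` is formally self-adjoint, and `e x = -1` that it
is formally anti-self-adjoint. -/

section NCPolynomials

variable {X : Type*}

/-- The formal adjoint on `ℝ⟨X⟩`: the linear anti-multiplicative map with `x ↦ e x • x`. -/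
def formalAdjoint (e : X → ℤ) (P : FreeAlgebra ℝ X) : FreeAlgebra ℝ X :=
  MulOpposite.unop
    (FreeAlgebra.lift ℝ (fun x => MulOpposite.op (e x • FreeAlgebra.ι ℝ x)) P)

/-- The coefficient of the word `w` in the noncommutative polynomial `P`. -/
def coeff (P : FreeAlgebra ℝ X) (w : FreeMonoid X) : ℝ :=
  (FreeAlgebra.equivMonoidAlgebraFreeMonoid P).coeff w

/-- The words occurring in `P`, i.e. those with a nonzero coefficient. -/
def words (P : FreeAlgebra ℝ X) : Set (FreeMonoid X) :=
  {w | coeff P w ≠ 0}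

/-- The noncommutative monomial given by a list of letters. -/
def monomial (l : List X) : FreeAlgebra ℝ X :=
  (l.map (FreeAlgebra.ι ℝ)).prod

/-- There is a bijection `w ↦ w'` of the words of `P` such that the adjoint of the monomial of `P`
at `w` is `s` times a cyclic rotation of the monomial of `P` at `w'`; here the monomial of `P` at a
word is the word together with its coefficient in `P`. -/
def IsCyclicAdjointUpTo (s : ℝ) (e : X → ℤ) (P : FreeAlgebra ℝ X) : Prop :=
  ∃ φ : words P ≃ words P, ∀ w : words P, ∃ σ : ℕ,
    formalAdjoint e (coeff P w • monomial (FreeMonoid.toList (w : FreeMonoid X))) =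
      s • (coeff P (φ w) • monomial ((FreeMonoid.toList (φ w : FreeMonoid X)).rotate σ))

/-- `P` is cyclic self-adjoint. -/
def IsCyclicSelfAdjoint (e : X → ℤ) (P : FreeAlgebra ℝ X) : Prop :=
  IsCyclicAdjointUpTo 1 e P

/-- `P` is cyclic anti-self-adjoint. -/
def IsCyclicAntiSelfAdjoint (e : X → ℤ) (P : FreeAlgebra ℝ X) : Prop :=
  IsCyclicAdjointUpTo (-1) e P

/-- `Tr_N` of the evaluation of `P` at complex `N × N` matrices. -/
def traceEval {N : ℕ} (K : X → Matrix (Fin N) (Fin N) ℂ) (P : FreeAlgebra ℝ X) : ℂ :=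
  (FreeAlgebra.lift ℝ K P).trace

end NCPolynomials

/-! ### Signatures, multi-indices and signs -/

/-- The diagonal entries of the metric `diag(+1, …, +1, -1, …, -1)` with `p` plus signs followed by
`q` minus signs. -/
def metricSign (p q : ℕ) (μ : Fin (p + q)) : ℤ :=
  if (μ : ℕ) < p then 1 else -1

/-- The quadratic form of signature `(p, q)` on `ℝ^(p+q)`. -/
def signatureForm (p q : ℕ) : QuadraticForm ℝ (Fin (p + q) → ℝ) :=
  QuadraticMap.weightedSumSquares ℝ (fun μ => (metricSign p q μ : ℝ))

/-- Strictly increasing tuples of spacetime indices of odd length, encoded as the sets of their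
entries. There are `2 ^ (d - 1)` of them if `d ≥ 1`. -/
abbrev OddIndex (d : ℕ) : Type :=
  {I : Finset (Fin d) // Odd I.card}

/-- The sign `e_I = (-1) ^ (u(I) + ⌊|I| / 2⌋)`, where `u(I)` is the number of indices in `I` whose
gamma matrix squares to `-1`. It is the sign with `(Γ^I)^* = e_I Γ^I`. -/
def indexSign (p q : ℕ) (I : OddIndex (p + q)) : ℤ :=
  (-1) ^ ((I.1.filter (fun μ => metricSign p q μ = -1)).card + I.1.card / 2)

/-- The KO-dimension `s = q - p` modulo `8`. -/
def koDim (p q : ℕ) : ZMod 8 := (q : ZMod 8) - (p : ZMod 8)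

/-- The sign `ε` as a function of `s` modulo `8`. -/
def koEps (s : ZMod 8) : ℤ :=
  (![1, 1, -1, -1, -1, -1, 1, 1] : Fin 8 → ℤ) s

/-- The sign `ε'` as a function of `s` modulo `8`. -/
def koEps' (s : ZMod 8) : ℤ :=
  (![1, -1, 1, 1, 1, -1, 1, 1] : Fin 8 → ℤ) s

/-- The sign `ε''` as a function of `s` modulo `8`. -/
def koEps'' (s : ZMod 8) : ℤ :=
  (![1, 1, -1, 1, 1, 1, -1, 1] : Fin 8 → ℤ) s

/-! ### Hermitian Clifford modules -/

/-- An irreducible Hermitian module `V` over the Clifford algebra of signature `(p, q)`: the first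
`p` gamma matrices are Hermitian (and square to `1`), the other `q` are anti-Hermitian (and square
to `-1`). -/
structure SpinorModule (p q : ℕ) (V : Type*) [NormedAddCommGroup V] [InnerProductSpace ℂ V] where
  /-- the Clifford action -/
  c : CliffordAlgebra (signatureForm p q) →ₐ[ℝ] Module.End ℂ V
  nontrivial : Nontrivial V
  irreducible : ∀ W : Submodule ℂ V, (∀ x, ∀ w ∈ W, c x w ∈ W) → W = ⊥ ∨ W = ⊤
  hermitian : ∀ (μ : Fin (p + q)) (v w : V),
    inner ℂ (c (CliffordAlgebra.ι (signatureForm p q) (Pi.single μ 1)) v) w =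
      (metricSign p q μ : ℂ) *
        inner ℂ v (c (CliffordAlgebra.ι (signatureForm p q) (Pi.single μ 1)) w)

namespace SpinorModule

variable {p q : ℕ} {V : Type*} [NormedAddCommGroup V] [InnerProductSpace ℂ V]

/-- The gamma matrix `γ^μ`. -/
def gamma (S : SpinorModule p q V) (μ : Fin (p + q)) : Module.End ℂ V :=
  S.c (CliffordAlgebra.ι (signatureForm p q) (Pi.single μ 1))

/-- The product `Γ^I = γ^{μ_1} ⋯ γ^{μ_r}` for `I = {μ_1 < ⋯ < μ_r}`. -/
def gammaProd (S : SpinorModule p q V) (I : Finset (Fin (p + q))) : Module.End ℂ V :=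
  ((I.sort (· ≤ ·)).map S.gamma).prod

/-- The chirality `(-i) ^ (s (s - 1) / 2) γ^1 ⋯ γ^{p+q}` with `s = q - p`. -/
def chirality (S : SpinorModule p q V) : Module.End ℂ V :=
  (-Complex.I) ^ ((((q : ℤ) - p) * ((q : ℤ) - p - 1)) / 2) • S.gammaProd Finset.univ

/-- The normalized trace `⟨I_1 … I_m⟩ = Tr_V(Γ^{I_1} ⋯ Γ^{I_m}) / dim V`. -/
def bracket (S : SpinorModule p q V) {m : ℕ} (I : Fin m → OddIndex (p + q)) : ℂ :=
  LinearMap.trace ℂ V (List.ofFn (fun j => S.gammaProd (I j).1)).prod / (Module.finrank ℂ V : ℂ)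

end SpinorModule

/-! ### Fuzzy geometries -/

section FuzzyGeometries

/-- The Hilbert space `V ⊗ M_N(ℂ)` of a fuzzy geometry (its inner product is `hilbertForm`). -/
abbrev HilbertSpace (N : ℕ) (V : Type*) [NormedAddCommGroup V] [InnerProductSpace ℂ V] : Type _ :=
  V ⊗[ℂ] Matrix (Fin N) (Fin N) ℂ

/-- The inner product `Tr(R^* S)` on `M_N(ℂ)`. -/
def matrixForm (N : ℕ) :
    Matrix (Fin N) (Fin N) ℂ →ₗ⋆[ℂ] Matrix (Fin N) (Fin N) ℂ →ₗ[ℂ] ℂ :=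
  LinearMap.mk₂'ₛₗ (starRingEnd ℂ) (RingHom.id ℂ) (fun R S => (R.conjTranspose * S).trace)
    (by intros; simp [add_mul]) (by intros; simp) (by intros; simp [mul_add]) (by intros; simp)

variable (N : ℕ) (V : Type*) [NormedAddCommGroup V] [InnerProductSpace ℂ V]

/-- The inner product on `V ⊗ M_N(ℂ)`, see `hilbertForm_tmul`. -/
def hilbertForm : HilbertSpace N V →ₗ⋆[ℂ] HilbertSpace N V →ₗ[ℂ] ℂ :=
  (TensorProduct.lift ((TensorProduct.mapBilinear (RingHom.id ℂ) V
      (Matrix (Fin N) (Fin N) ℂ) ℂ ℂ).compr₂ (LinearMap.llcomp ℂ _ _ _ (LinearMap.mul' ℂ ℂ)))) ∘ₛₗ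
    TensorProduct.map (innerₛₗ ℂ) (matrixForm N)

theorem hilbertForm_tmul (v w : V) (R S : Matrix (Fin N) (Fin N) ℂ) :
    hilbertForm N V (v ⊗ₜ R) (w ⊗ₜ S) = inner ℂ v w * (R.conjTranspose * S).trace := rfl

variable {V}

/-- The representation `ρ(a) (v ⊗ R) = v ⊗ a R`. -/
def leftRep {N : ℕ} (a : Matrix (Fin N) (Fin N) ℂ) : Module.End ℂ (HilbertSpace N V) :=
  TensorProduct.map LinearMap.id (LinearMap.mulLeft ℂ a)

/-- The anti-linear map `J = C ⊗ *`, that is `J (v ⊗ R) = C v ⊗ R^*`. -/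
def realStructure (C : V ≃ₗᵢ⋆[ℂ] V) : HilbertSpace N V ≃ₗ⋆[ℂ] HilbertSpace N V :=
  TensorProduct.congr C.toLinearEquiv (starLinearEquiv ℂ)

theorem realStructure_tmul (C : V ≃ₗᵢ⋆[ℂ] V) (v : V) (R : Matrix (Fin N) (Fin N) ℂ) :
    realStructure N C (v ⊗ₜ R) = C v ⊗ₜ R.conjTranspose := rfl

end FuzzyGeometries

/-- A fuzzy geometry of signature `(p, q)`, with `p + q` even, over the algebra `M_N(ℂ)` and with
spinor space `V`. -/
structure FuzzyGeometry (p q N : ℕ) (V : Type*) [NormedAddCommGroup V] [InnerProductSpace ℂ V]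
    extends SpinorModule p q V where
  /-- the anti-unitary map on `V` that defines the real structure `J = C ⊗ *` -/
  C : V ≃ₗᵢ⋆[ℂ] V
  C_sq : ∀ v, C (C v) = koEps (koDim p q) • v
  C_gamma : ∀ μ v, C (toSpinorModule.gamma μ v) = koEps' (koDim p q) • toSpinorModule.gamma μ (C v)
  C_chirality : ∀ v,
    C (toSpinorModule.chirality v) = koEps'' (koDim p q) • toSpinorModule.chirality (C v)
  /-- the Dirac operator -/
  D : Module.End ℂ (HilbertSpace N V)
  selfAdjoint : ∀ x y, hilbertForm N V (D x) y = hilbertForm N V x (D y)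
  /-- the order-one condition `[[D, ρ(a)], J ρ(b) J⁻¹] = 0` -/
  orderOne : ∀ (a b : Matrix (Fin N) (Fin N) ℂ) (x : HilbertSpace N V),
    ⁅D, leftRep a⁆ (realStructure N C (leftRep b ((realStructure N C).symm x))) =
      realStructure N C (leftRep b ((realStructure N C).symm (⁅D, leftRep a⁆ x)))
  J_D : ∀ x, realStructure N C (D x) = koEps' (koDim p q) • D (realStructure N C x)
  /-- the Dirac operator anti-commutes with the chirality `γ ⊗ 1` -/
  D_chirality :
    D * TensorProduct.map toSpinorModule.chirality LinearMap.id =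
      -(TensorProduct.map toSpinorModule.chirality LinearMap.id * D)

/-! ### Parametrization by matrices, and the single-trace and bi-trace functionals -/

section Functionals

variable {p q N : ℕ} {V : Type*} [NormedAddCommGroup V] [InnerProductSpace ℂ V]

/-- The operator `R ↦ K R + e R K` on `M_N(ℂ)`. -/
def letterOp (e : ℤ) (K : Matrix (Fin N) (Fin N) ℂ) : Module.End ℂ (Matrix (Fin N) (Fin N) ℂ) :=
  LinearMap.mulLeft ℂ K + e • LinearMap.mulRight ℂ K

/-- The matrices `K_I` parametrize the Dirac operator: `K_I^* = e_I K_I` and `D = ∑_I Γ^I ⊗ k_I`,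
where `k_I(R) = K_I R + e_I R K_I`. -/
def FuzzyGeometry.IsParametrizedBy (G : FuzzyGeometry p q N V)
    (K : OddIndex (p + q) → Matrix (Fin N) (Fin N) ℂ) : Prop :=
  (∀ I, (K I).conjTranspose = indexSign p q I • K I) ∧
    G.D = ∑ I : OddIndex (p + q),
      TensorProduct.map (G.gammaProd I.1) (letterOp (indexSign p q I) (K I))

/-- The spectral action `Tr f(D)`, the trace being taken over `V ⊗ M_N(ℂ)`. -/
def FuzzyGeometry.spectralAction (G : FuzzyGeometry p q N V) (f : Polynomial ℝ) : ℂ :=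
  LinearMap.trace ℂ (HilbertSpace N V)
    (Polynomial.aeval G.D (f.map (algebraMap ℝ ℂ)))

/-- The product of the `M j` over `j ∈ A`, in increasing order of `j`. -/
def orderedProd {m : ℕ} (A : Finset (Fin m)) (M : Fin m → Matrix (Fin N) (Fin N) ℂ) :
    Matrix (Fin N) (Fin N) ℂ :=
  ((A.sort (· ≤ ·)).map M).prod

/-- The single-trace functional of degree `m`:
`∑_{I_1,…,I_m} ⟨I_1 … I_m⟩ (Tr_N(K_{I_1} ⋯ K_{I_m}) + e_{I_1} ⋯ e_{I_m} Tr_N(K_{I_m} ⋯ K_{I_1}))`. -/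
def singleTrace (S : SpinorModule p q V) (K : OddIndex (p + q) → Matrix (Fin N) (Fin N) ℂ)
    (m : ℕ) : ℂ :=
  ∑ I : Fin m → OddIndex (p + q), S.bracket I *
    ((List.ofFn (fun j => K (I j))).prod.trace +
      ((∏ j, indexSign p q (I j) : ℤ) : ℂ) * (List.ofFn (fun j => K (I j))).reverse.prod.trace)

/-- The bi-trace functional of degree `m`: the sum over `I_1, …, I_m` of `⟨I_1 … I_m⟩` times
`∑_Υ (∏_{j ∈ Υ} e_{I_j}) Tr_N(∏_{j ∉ Υ} K_{I_j}) Tr_N(∏_{j ∈ Υ} K_{I_j}^T)`, where `Υ` runs over the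
subsets of `{1, …, m}` which are neither empty nor everything. -/
def biTrace (S : SpinorModule p q V) (K : OddIndex (p + q) → Matrix (Fin N) (Fin N) ℂ)
    (m : ℕ) : ℂ :=
  ∑ I : Fin m → OddIndex (p + q), S.bracket I *
    ∑ Y : Finset (Fin m) with Y ≠ ∅ ∧ Yᶜ ≠ ∅,
      ((∏ j ∈ Y, indexSign p q (I j) : ℤ) : ℂ) *
        (orderedProd Yᶜ (fun j => K (I j))).trace *
        (orderedProd Y (fun j => (K (I j)).transpose)).trace

/-- The single-trace functional of a polynomial `f` without constant term. -/
def singleTracePoly (S : SpinorModule p q V) (K : OddIndex (p + q) → Matrix (Fin N) (Fin N) ℂ)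
    (f : Polynomial ℝ) : ℂ :=
  ∑ m ∈ f.support, (f.coeff m : ℂ) * singleTrace S K m

/-- The bi-trace functional of a polynomial `f` without constant term. -/
def biTracePoly (S : SpinorModule p q V) (K : OddIndex (p + q) → Matrix (Fin N) (Fin N) ℂ)
    (f : Polynomial ℝ) : ℂ :=
  ∑ m ∈ f.support, (f.coeff m : ℂ) * biTrace S K m

end Functionals

end FuzzyGeom

end

/-!
Everything below takes place in an arbitrary even dimension `p + q`.

**Parametrization.** By irreducibility and Burnside's theorem, the products `Γ^J` over all sets `J`
of indices span `End V`; they are linearly independent because they are orthogonal for the trace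
form (`SpinorModule.trace_gammaProd_mul`). So `D = ∑_J Γ^J ⊗ X_J` with unique `X_J`, and each axiom
on `D` is an axiom on every `X_J`. Anticommutation with the chirality kills the even `J`. The
order-one condition says that `[X_I, a ·]` commutes with right multiplications, so that `X_I` is a
derivation of `M_N(ℂ)` up to a right multiplication; derivations being inner,
`X_I(R) = A R + R B`. Self-adjointness and reality express `X_I` in three more ways, with `(A, B)`
replaced by `(e A^*, e B^*)`, `(B^*, A^*)` and `(e B, e A)`. The average of the four expressions is
`R ↦ K R + e R K` with `K^* = e K` (`FuzzyGeometry.exists_isParametrizedBy`).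

**Trace formula.** Expanding `D^m` and then `k_{I_1} ⋯ k_{I_m}` gives a sum over the sets `Υ` of
the positions at which the matrix acts on the right. As `Tr(R ↦ A R B) = Tr A Tr B`, the sets
`Υ = ∅` and `Υ = {1, …, m}` give `N` times the single-trace functional, and the others give the
bi-trace functional (`FuzzyGeometry.trace_pow_D`).

**Polynomials.** Reordering a product of gamma matrices shows that `⟨I_1 … I_m⟩` is a real number
that depends on the signature only (`exists_bracket_eq`); taking adjoints, it equals
`e_{I_1} ⋯ e_{I_m} ⟨I_m … I_1⟩` (`SpinorModule.star_bracket`). If `Q = ∑ f_m ⟨I⟩ z_{I_1} ⋯ z_{I_m}`,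
then the single-trace functional is `Tr_N (Q + Q^*)`, by definition. The bi-trace functional is a
combination of terms `Tr u Tr w^*` with words `u`, `w`, and reversing the order of the factors turns
it into the same combination of the terms `Tr u^* Tr w` (`biTrace_eq_adjoint`). Now
`u ⊗ w^* + u^* ⊗ w = (1/2) ∑_{s = ±1} s (u + s u^*) ⊗ (w + s w^*)`,
whose factors are self-adjoint for `s = 1` and anti-self-adjoint for `s = -1`. No rotation of the
letters is needed: an (anti-)self-adjoint polynomial is cyclic (anti-)self-adjoint by reversal of
its words (`isCyclicAdjointUpTo_of_formalAdjoint_eq`).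
-/

noncomputable section

/-! ### Words in the Clifford algebra and their traces -/

namespace FuzzyGeom

section CliffordWords

variable {p q : ℕ}

/-- The generator of the Clifford algebra that acts as `γ^μ` on spinors. -/
def cliffordGen (p q : ℕ) (μ : Fin (p + q)) : CliffordAlgebra (signatureForm p q) :=
  CliffordAlgebra.ι (signatureForm p q) (Pi.single μ 1)

/-- The product of the generators with the indices in `l`, in the order of `l`. -/
def cliffordWord (p q : ℕ) (l : List (Fin (p + q))) : CliffordAlgebra (signatureForm p q) :=
  (l.map (cliffordGen p q)).prod

@[simp] theorem cliffordWord_nil : cliffordWord p q [] = 1 := rfl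

@[simp] theorem cliffordWord_cons (μ : Fin (p + q)) (l : List (Fin (p + q))) :
    cliffordWord p q (μ :: l) = cliffordGen p q μ * cliffordWord p q l := by
  simp [cliffordWord]

theorem cliffordWord_append (l l' : List (Fin (p + q))) :
    cliffordWord p q (l ++ l') = cliffordWord p q l * cliffordWord p q l' := by
  simp [cliffordWord]

theorem signatureForm_single (μ : Fin (p + q)) :
    signatureForm p q (Pi.single μ 1) = metricSign p q μ := by
  rw [signatureForm, QuadraticMap.weightedSumSquares_apply, Finset.sum_eq_single μ]
  · simp
  · intro ν _ h; simp [h]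
  · simp

theorem cliffordGen_mul_self (μ : Fin (p + q)) :
    cliffordGen p q μ * cliffordGen p q μ = (metricSign p q μ : ℝ) • 1 := by
  rw [cliffordGen, CliffordAlgebra.ι_sq_scalar, signatureForm_single,
    Algebra.algebraMap_eq_smul_one]

theorem metricSign_mul_self (μ : Fin (p + q)) : metricSign p q μ * metricSign p q μ = 1 := by
  unfold metricSign; split_ifs <;> norm_num

theorem cliffordGen_mul_of_ne {μ ν : Fin (p + q)} (h : μ ≠ ν) :
    cliffordGen p q μ * cliffordGen p q ν = -(cliffordGen p q ν * cliffordGen p q μ) := by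
  apply CliffordAlgebra.ι_mul_ι_comm_of_isOrtho
  rw [QuadraticMap.isOrtho_def]
  simp only [signatureForm, QuadraticMap.weightedSumSquares_apply, ← Finset.sum_add_distrib]
  refine Finset.sum_congr rfl fun κ _ => ?_
  rcases eq_or_ne κ μ with rfl | h1
  · simp [h]
  · simp [h1]

theorem cliffordGen_mul_word (μ : Fin (p + q)) (l : List (Fin (p + q))) :
    cliffordGen p q μ * cliffordWord p q l =
      (-1 : ℝ) ^ (l.length + l.count μ) • (cliffordWord p q l * cliffordGen p q μ) := by
  induction l with
  | nil => simp
  | cons ν l ih =>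
    rcases eq_or_ne μ ν with rfl | h
    · simp only [cliffordWord_cons, List.length_cons, List.count_cons_self]
      nth_rw 1 [ih]
      rw [mul_smul_comm, mul_assoc, ← add_assoc, add_right_comm l.length 1, pow_succ, pow_succ]
      simp
    · simp only [cliffordWord_cons, List.length_cons, List.count_cons_of_ne h.symm]
      rw [← mul_assoc, cliffordGen_mul_of_ne h, neg_mul, mul_assoc, ih, mul_smul_comm, mul_assoc,
        add_right_comm, pow_succ]
      simp

theorem cliffordWord_mul_reverse (l : List (Fin (p + q))) :
    cliffordWord p q l * cliffordWord p q l.reverse =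
      ((l.map (metricSign p q)).prod : ℝ) • 1 := by
  induction l with
  | nil => simp
  | cons μ l ih =>
    rw [List.reverse_cons, cliffordWord_append, cliffordWord_cons μ l, mul_assoc,
      ← mul_assoc (cliffordWord p q l), ih]
    simp [cliffordGen_mul_self, smul_smul, mul_comm]

theorem cliffordWord_perm {l l' : List (Fin (p + q))} (h : l.Perm l') :
    ∃ s : ℝ, cliffordWord p q l = s • cliffordWord p q l' := by
  induction h with
  | nil => exact ⟨1, by simp⟩
  | cons μ _ ih =>
    obtain ⟨s, hs⟩ := ih
    exact ⟨s, by simp [hs]⟩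
  | swap μ ν l =>
    rcases eq_or_ne μ ν with rfl | h
    · exact ⟨1, by simp⟩
    · exact ⟨-1, by simp [← mul_assoc, cliffordGen_mul_of_ne h]⟩
  | trans _ _ ih ih' =>
    obtain ⟨s, hs⟩ := ih
    obtain ⟨t, ht⟩ := ih'
    exact ⟨s * t, by rw [hs, ht, smul_smul]⟩

/-- Every word in the generators is a multiple of one with strictly increasing letters: sort the
letters, and cancel those that occur twice. -/
theorem exists_cliffordWord_eq_smul_sort (l : List (Fin (p + q))) :
    ∃ (s : ℝ) (J : Finset (Fin (p + q))),
      cliffordWord p q l = s • cliffordWord p q (J.sort (· ≤ ·)) := by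
  induction hn : l.length using Nat.strong_induction_on generalizing l with
  | _ n ih =>
    by_cases hl : l.Nodup
    · obtain ⟨s, hs⟩ := cliffordWord_perm (p := p) (q := q)
        (l := l) (l' := l.toFinset.sort (· ≤ ·))
        ((List.perm_ext_iff_of_nodup hl (Finset.sort_nodup _ _)).2 (by simp))
      exact ⟨s, _, hs⟩
    · obtain ⟨μ, hμ⟩ := List.exists_duplicate_iff_not_nodup.2 hl
      obtain ⟨l', hl'⟩ := (List.duplicate_iff_sublist.1 hμ).exists_perm_append
      obtain ⟨s, hs⟩ := cliffordWord_perm hl'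
      have hlen := hl'.length_eq
      simp only [List.cons_append, List.nil_append, List.length_cons] at hlen
      obtain ⟨t, J, ht⟩ := ih l'.length (by omega) l' rfl
      refine ⟨s * (metricSign p q μ * t), J, ?_⟩
      rw [hs]
      simp only [List.cons_append, List.nil_append, cliffordWord_cons]
      rw [← mul_assoc, cliffordGen_mul_self, ht]
      simp [smul_smul, mul_comm t]

theorem span_cliffordWord_sort :
    Submodule.span ℝ (Set.range fun J : Finset (Fin (p + q)) =>
      cliffordWord p q (J.sort (· ≤ ·))) = ⊤ := by
  set W := Submodule.span ℝ (Set.range fun J : Finset (Fin (p + q)) =>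
      cliffordWord p q (J.sort (· ≤ ·))) with hW
  have hword (l) : cliffordWord p q l ∈ W := by
    obtain ⟨s, J, h⟩ := exists_cliffordWord_eq_smul_sort (p := p) (q := q) l
    rw [h]
    exact W.smul_mem _ (Submodule.subset_span ⟨J, rfl⟩)
  have hmul (x y) (hx : x ∈ W) (hy : y ∈ W) : x * y ∈ W := by
    have := Submodule.mul_mem_mul hx hy
    rw [hW, Submodule.span_mul_span] at this
    refine Submodule.span_le.2 ?_ this
    rintro _ ⟨_, ⟨I, rfl⟩, _, ⟨J, rfl⟩, rfl⟩
    have h := hword (I.sort (· ≤ ·) ++ J.sort (· ≤ ·))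
    rwa [cliffordWord_append] at h
  refine Submodule.eq_top_iff'.2 fun x => ?_
  induction x using CliffordAlgebra.induction with
  | algebraMap r =>
    rw [Algebra.algebraMap_eq_smul_one]
    exact W.smul_mem _ (hword [])
  | ι v =>
    rw [← Finset.univ_sum_single v, map_sum]
    refine W.sum_mem fun μ _ => ?_
    have : Pi.single μ (v μ) = v μ • (Pi.single μ 1 : Fin (p + q) → ℝ) := by
      rw [← Pi.single_smul]; simp
    rw [this, map_smul]
    simpa [cliffordGen] using W.smul_mem (v μ) (hword [μ])
  | mul x y hx hy => exact hmul x y hx hy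
  | add x y hx hy => exact W.add_mem hx hy

/-- The sign that in `e_I` appears as `(-1) ^ ⌊|I| / 2⌋`. -/
theorem cliffordWord_reverse {l : List (Fin (p + q))} (hl : l.Nodup) :
    cliffordWord p q l.reverse = (-1 : ℝ) ^ (l.length / 2) • cliffordWord p q l := by
  induction l with
  | nil => simp
  | cons μ l ih =>
    obtain ⟨h1, h2⟩ := List.nodup_cons.1 hl
    rw [List.reverse_cons, cliffordWord_append, ih h2, cliffordWord_cons μ l,
      cliffordGen_mul_word, List.count_eq_zero_of_not_mem h1]
    simp only [cliffordWord_cons, cliffordWord_nil, mul_one, smul_smul, smul_mul_assoc, ← pow_add,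
      List.length_cons]
    congr 1
    rcases Nat.even_or_odd' l.length with ⟨k, hk | hk⟩
    · rw [hk, show 2 * k / 2 = k by omega, show (2 * k + 1) / 2 + (2 * k + 0) = k + 2 * k by omega,
        pow_add _ k, pow_mul]; simp
    · rw [hk, show (2 * k + 1) / 2 = k by omega,
        show (2 * k + 1 + 1) / 2 + (2 * k + 1 + 0) = k + 2 * (k + 1) by omega,
        pow_add _ k, pow_mul]; simp

end CliffordWords

namespace SpinorModule

variable {p q : ℕ} {V : Type*} [NormedAddCommGroup V] [InnerProductSpace ℂ V]

theorem c_cliffordWord (S : SpinorModule p q V) (l : List (Fin (p + q))) :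
    S.c (cliffordWord p q l) = (l.map S.gamma).prod := by
  rw [cliffordWord, map_list_prod, List.map_map]; rfl

theorem gammaProd_eq_c (S : SpinorModule p q V) (J : Finset (Fin (p + q))) :
    S.gammaProd J = S.c (cliffordWord p q (J.sort (· ≤ ·))) := (S.c_cliffordWord _).symm

theorem gamma_mul_gammaProd (S : SpinorModule p q V) (μ : Fin (p + q)) (J : Finset (Fin (p + q))) :
    S.gamma μ * S.gammaProd J =
      (-1 : ℂ) ^ (J.card + if μ ∈ J then 1 else 0) • (S.gammaProd J * S.gamma μ) := by
  have h := congrArg S.c (cliffordGen_mul_word μ (J.sort (· ≤ ·)))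
  rw [map_mul, map_smul, map_mul, ← gammaProd_eq_c, Finset.length_sort] at h
  have h2 : (J.sort (· ≤ ·)).count μ = if μ ∈ J then 1 else 0 := by
    rw [(Finset.sort_nodup _ _).count]; simp
  rw [h2] at h
  refine h.trans ?_
  rw [← Complex.coe_smul]
  push_cast
  rfl

theorem gamma_mul_self (S : SpinorModule p q V) (μ : Fin (p + q)) :
    S.gamma μ * S.gamma μ = (metricSign p q μ : ℂ) • 1 := by
  have h := congrArg S.c (cliffordGen_mul_self μ)
  rw [map_mul, map_smul, map_one, ← Complex.coe_smul] at h
  simpa using! h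

@[simp] theorem gammaProd_empty (S : SpinorModule p q V) : S.gammaProd ∅ = 1 := by
  simp [gammaProd]

/-- The trace of `γ^μ T γ^μ` is `± Tr T` by cyclicity, and `∓ Tr T` by anticommutation. -/
theorem trace_eq_zero_of_anticomm (S : SpinorModule p q V) {μ : Fin (p + q)} {T : Module.End ℂ V}
    (h : S.gamma μ * T = -(T * S.gamma μ)) : LinearMap.trace ℂ V T = 0 := by
  have h1 : LinearMap.trace ℂ V (S.gamma μ * T * S.gamma μ) =
      metricSign p q μ * LinearMap.trace ℂ V T := by
    rw [LinearMap.trace_mul_comm, ← mul_assoc, gamma_mul_self]; simp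
  have h2 : LinearMap.trace ℂ V (S.gamma μ * T * S.gamma μ) =
      -(metricSign p q μ * LinearMap.trace ℂ V T) := by
    rw [h, neg_mul, mul_assoc, gamma_mul_self]; simp
  have h3 : (metricSign p q μ : ℂ) ≠ 0 := by
    have := metricSign_mul_self μ
    intro h0
    have h4 : metricSign p q μ = 0 := by exact_mod_cast h0
    simp [h4] at this
  exact (mul_eq_zero.1 (self_eq_neg.1 (h1.symm.trans h2))).resolve_left h3

/-- In even dimension, the products `Γ^I` are orthogonal for the trace form: conjugation by a
suitable gamma matrix fixes one of `Γ^I`, `Γ^J` and changes the sign of the other one. -/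
theorem trace_gammaProd_mul (hd : Even (p + q)) (S : SpinorModule p q V)
    {I J : Finset (Fin (p + q))} (hIJ : I ≠ J) :
    LinearMap.trace ℂ V (S.gammaProd I * S.gammaProd J) = 0 := by
  -- if no index worked, then `J` would be `I` or its complement
  obtain ⟨μ, hμ⟩ : ∃ μ, Odd ((I.card + if μ ∈ I then 1 else 0) +
      (J.card + if μ ∈ J then 1 else 0)) := by
    by_contra! hne
    simp only [Nat.not_odd_iff_even] at hne
    rcases Nat.even_or_odd (I.card + J.card) with h | h
    · refine hIJ (Finset.ext fun μ => ?_)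
      have := hne μ
      split_ifs at this <;> grind
    · have : J = Iᶜ := Finset.ext fun μ => by
        have := hne μ
        rw [Finset.mem_compl]
        split_ifs at this <;> grind
      rw [this, Finset.card_add_card_compl, Fintype.card_fin] at h
      exact Nat.not_even_iff_odd.2 h hd
  refine S.trace_eq_zero_of_anticomm (μ := μ) ?_
  rw [← mul_assoc, gamma_mul_gammaProd, smul_mul_assoc, mul_assoc, gamma_mul_gammaProd,
    mul_smul_comm, smul_smul, ← pow_add, hμ.neg_one_pow, neg_one_smul, mul_assoc]

theorem trace_gammaProd (hd : Even (p + q)) (S : SpinorModule p q V)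
    {J : Finset (Fin (p + q))} (hJ : J ≠ ∅) : LinearMap.trace ℂ V (S.gammaProd J) = 0 := by
  simpa using S.trace_gammaProd_mul hd hJ.symm

end SpinorModule

/-- The normalized trace of a Clifford algebra element is a real number that depends neither on
the module nor on its inner product. -/
theorem exists_trace_c_eq {p q : ℕ} (hd : Even (p + q)) (x : CliffordAlgebra (signatureForm p q)) :
    ∃ r : ℝ, ∀ (V : Type*) [NormedAddCommGroup V] [InnerProductSpace ℂ V]
      [FiniteDimensional ℂ V] (S : SpinorModule p q V),
      LinearMap.trace ℂ V (S.c x) = r * (Module.finrank ℂ V : ℂ) := by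
  have hx : x ∈ Submodule.span ℝ (Set.range fun J : Finset (Fin (p + q)) =>
      cliffordWord p q (J.sort (· ≤ ·))) := span_cliffordWord_sort (p := p) (q := q) ▸ trivial
  induction hx using Submodule.span_induction with
  | mem x hx =>
    obtain ⟨J, rfl⟩ := hx
    rcases eq_or_ne J ∅ with rfl | hJ
    · exact ⟨1, fun V _ _ _ S => by simp⟩
    · refine ⟨0, fun V _ _ _ S => ?_⟩
      simpa [← S.gammaProd_eq_c] using S.trace_gammaProd hd hJ
  | zero => exact ⟨0, by simp⟩
  | add x y _ _ hx hy =>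
    obtain ⟨r, hr⟩ := hx
    obtain ⟨t, ht⟩ := hy
    exact ⟨r + t, fun V _ _ _ S => by simp [hr V S, ht V S, add_mul]⟩
  | smul a x _ hx =>
    obtain ⟨r, hr⟩ := hx
    refine ⟨a * r, fun V _ _ _ S => ?_⟩
    rw [map_smul, ← Complex.coe_smul, map_smul, hr V S, smul_eq_mul]
    push_cast; ring

/-- The bracket `⟨I_1 … I_m⟩` is a real number determined by the signature. -/
theorem exists_bracket_eq {p q : ℕ} (hd : Even (p + q)) {m : ℕ} (I : Fin m → OddIndex (p + q)) :
    ∃ r : ℝ, ∀ (V : Type*) [NormedAddCommGroup V] [InnerProductSpace ℂ V]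
      [FiniteDimensional ℂ V] (S : SpinorModule p q V), S.bracket I = r := by
  obtain ⟨r, hr⟩ := exists_trace_c_eq hd
    (List.ofFn fun j => cliffordWord p q ((I j).1.sort (· ≤ ·))).prod
  refine ⟨r, fun V _ _ _ S => ?_⟩
  have : Nontrivial V := S.nontrivial
  have h0 : (Module.finrank ℂ V : ℂ) ≠ 0 := by
    exact_mod_cast (Module.finrank_pos (R := ℂ) (M := V)).ne'
  rw [SpinorModule.bracket, div_eq_iff h0, ← hr V S, map_list_prod S.c, List.map_ofFn]
  simp only [S.gammaProd_eq_c, Function.comp_def]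

end FuzzyGeom

/-! ### Products of gamma matrices -/

theorem List.ofFn_reverse_eq {α : Type*} {m : ℕ} (f : Fin m → α) :
    (List.ofFn f).reverse = List.ofFn fun j => f j.rev := by
  rw [List.ofFn_eq_map, List.ofFn_eq_map, ← List.map_reverse, List.finRange_reverse, List.map_map]
  rfl

/-- Burnside's theorem on irreducible matrix algebras. -/
theorem Subalgebra.eq_top_of_irreducible {V : Type*} [AddCommGroup V] [Module ℂ V]
    [FiniteDimensional ℂ V] [Nontrivial V] (A : Subalgebra ℂ (Module.End ℂ V))
    (hA : ∀ W : Submodule ℂ V, (∀ a ∈ A, ∀ w ∈ W, a w ∈ W) → W = ⊥ ∨ W = ⊤) : A = ⊤ := by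
  have : IsSimpleModule A V := by
    rw [isSimpleModule_iff]
    refine { eq_bot_or_eq_top := fun W => ?_ }
    rcases hA (W.restrictScalars ℂ) fun a ha w hw => W.smul_mem ⟨a, ha⟩ hw with h | h
    · exact Or.inl ((Submodule.restrictScalars_eq_bot_iff ..).1 h)
    · exact Or.inr ((Submodule.restrictScalars_eq_top_iff ..).1 h)
  -- Schur's lemma: an eigenspace of an `A`-linear map is invariant, hence everything
  have schur (φ : Module.End A V) : ∃ z : ℂ, ∀ v, φ v = z • v := by
    obtain ⟨z, hz⟩ := Module.End.exists_eigenvalue (φ.restrictScalars ℂ : Module.End ℂ V)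
    refine ⟨z, fun v => ?_⟩
    have hinv := hA (Module.End.eigenspace (φ.restrictScalars ℂ : Module.End ℂ V) z)
      fun a ha w hw => by
        rw [Module.End.mem_eigenspace_iff] at hw ⊢
        change φ ((⟨a, ha⟩ : A) • w) = _
        rw [map_smul, show φ w = z • w from hw]
        exact map_smul a z w
    have : v ∈ Module.End.eigenspace (φ.restrictScalars ℂ : Module.End ℂ V) z := by
      rw [hinv.resolve_left hz]; trivial
    exact Module.End.mem_eigenspace_iff.1 this
  refine Algebra.eq_top_iff.2 fun T => ?_
  let T' : Module.End (Module.End A V) V :=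
    { toFun := T
      map_add' := map_add T
      map_smul' := fun φ v => by
        obtain ⟨z, hz⟩ := schur φ
        simp [Module.End.smul_def, hz] }
  classical
  let b := Module.finBasis ℂ V
  obtain ⟨r, hr⟩ := jacobson_density T' (Finset.univ.image b)
  have : T = r := b.ext fun i => hr (b i) (by simp)
  rw [this]
  exact r.2

namespace FuzzyGeom

namespace SpinorModule

variable {p q : ℕ} {V : Type*} [NormedAddCommGroup V] [InnerProductSpace ℂ V]

/-- The image of the Clifford algebra acts irreducibly, so over `ℂ` it spans `End V`. -/
theorem span_gammaProd [FiniteDimensional ℂ V] (S : SpinorModule p q V) :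
    Submodule.span ℂ (Set.range S.gammaProd) = ⊤ := by
  have := S.nontrivial
  have hc (x) : S.c x ∈ Submodule.span ℂ (Set.range S.gammaProd) := by
    have hx : x ∈ Submodule.span ℝ (Set.range fun J : Finset (Fin (p + q)) =>
      cliffordWord p q (J.sort (· ≤ ·))) := span_cliffordWord_sort (p := p) (q := q) ▸ trivial
    induction hx using Submodule.span_induction with
    | mem x hx =>
      obtain ⟨J, rfl⟩ := hx
      exact Submodule.subset_span ⟨J, S.gammaProd_eq_c J⟩
    | zero => simp
    | add x y _ _ hx hy => rw [map_add]; exact Submodule.add_mem _ hx hy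
    | smul a x _ hx => rw [map_smul, ← Complex.coe_smul]; exact Submodule.smul_mem _ _ hx
  have htop : Algebra.adjoin ℂ (Set.range S.c) = ⊤ :=
    Subalgebra.eq_top_of_irreducible _ fun W hW => S.irreducible W fun x w hw =>
      hW _ (Algebra.subset_adjoin ⟨x, rfl⟩) w hw
  rw [eq_top_iff, ← Algebra.top_toSubmodule, ← htop, Algebra.adjoin_eq_span]
  refine Submodule.span_le.2 fun T hT => ?_
  obtain ⟨x, rfl⟩ : T ∈ MonoidHom.mrange S.c.toRingHom.toMonoidHom :=
    Submonoid.closure_le.2 (by rintro _ ⟨x, rfl⟩; exact ⟨x, rfl⟩) hT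
  exact hc x

theorem gammaProd_mul_self (S : SpinorModule p q V) (J : Finset (Fin (p + q))) :
    ∃ s : ℂ, s ≠ 0 ∧ S.gammaProd J * S.gammaProd J = s • 1 := by
  have h := congrArg S.c (cliffordWord_mul_reverse (J.sort (· ≤ ·)))
  rw [cliffordWord_reverse (Finset.sort_nodup _ _), mul_smul_comm, map_smul, map_smul, map_mul,
    map_one, ← gammaProd_eq_c, ← Complex.coe_smul, ← Complex.coe_smul] at h
  have h1 : (((-1 : ℝ) ^ ((J.sort (· ≤ ·)).length / 2) : ℝ) : ℂ) ≠ 0 := by simp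
  have h2 : (((((J.sort (· ≤ ·)).map (metricSign p q)).prod : ℤ) : ℝ) : ℂ) ≠ 0 := by
    simp only [ne_eq, Complex.ofReal_eq_zero, Int.cast_eq_zero, List.prod_eq_zero_iff, List.mem_map,
      not_exists, not_and]
    intro μ _ h0
    simpa [h0] using metricSign_mul_self μ
  refine ⟨_, mul_ne_zero (inv_ne_zero h1) h2, ?_⟩
  rw [mul_smul, ← h, smul_smul, inv_mul_cancel₀ h1, one_smul]

theorem linearIndependent_gammaProd (hd : Even (p + q)) [FiniteDimensional ℂ V]
    (S : SpinorModule p q V) : LinearIndependent ℂ S.gammaProd := by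
  have := S.nontrivial
  refine Fintype.linearIndependent_iff.2 fun a h I => ?_
  obtain ⟨s, hs, hI⟩ := S.gammaProd_mul_self I
  have h1 := congrArg (fun T => LinearMap.trace ℂ V (S.gammaProd I * T)) h
  simp only [Finset.mul_sum, map_sum, mul_smul_comm, map_smul, mul_zero, map_zero] at h1
  rw [Finset.sum_eq_single I (fun J _ hJ => by rw [S.trace_gammaProd_mul hd hJ.symm, smul_zero])
    (by simp), hI, map_smul, LinearMap.trace_one] at h1
  have h0 : (Module.finrank ℂ V : ℂ) ≠ 0 := by
    exact_mod_cast (Module.finrank_pos (R := ℂ) (M := V)).ne'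
  simpa [hs, h0] using h1

theorem inner_c_cliffordWord (S : SpinorModule p q V) (l : List (Fin (p + q))) (v w : V) :
    inner ℂ (S.c (cliffordWord p q l) v) w =
      ((l.map (metricSign p q)).prod : ℂ) * inner ℂ v (S.c (cliffordWord p q l.reverse) w) := by
  induction l generalizing v w with
  | nil => simp
  | cons μ l ih =>
    rw [cliffordWord_cons, map_mul, Module.End.mul_apply, cliffordGen, S.hermitian, ih,
      List.reverse_cons, cliffordWord_append, map_mul, Module.End.mul_apply]
    simp [cliffordGen, mul_assoc]

/-- `(Γ^I)^* = e_I Γ^I`. -/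
theorem inner_gammaProd (S : SpinorModule p q V) (I : OddIndex (p + q)) (v w : V) :
    inner ℂ (S.gammaProd I.1 v) w = (indexSign p q I : ℂ) * inner ℂ v (S.gammaProd I.1 w) := by
  rw [gammaProd_eq_c, inner_c_cliffordWord, cliffordWord_reverse (Finset.sort_nodup _ _), map_smul,
    ← Complex.coe_smul, LinearMap.smul_apply, inner_smul_right, ← mul_assoc, Finset.length_sort]
  congr 1
  have h : ((I.1.sort (· ≤ ·)).map (metricSign p q)).prod = ∏ μ ∈ I.1, metricSign p q μ := by
    rw [← List.prod_toFinset _ (Finset.sort_nodup _ _), Finset.sort_toFinset]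
  have h2 : ∏ μ ∈ I.1, metricSign p q μ =
      (-1) ^ (I.1.filter fun μ => metricSign p q μ = -1).card := by
    rw [Finset.card_filter, ← Finset.prod_pow_eq_pow_sum]
    refine Finset.prod_congr rfl fun μ _ => ?_
    unfold metricSign
    split_ifs <;> simp_all
  rw [h, h2, indexSign, pow_add]
  push_cast
  rfl

theorem inner_gammaProd_list (S : SpinorModule p q V) (l : List (OddIndex (p + q))) (v w : V) :
    inner ℂ ((l.map fun I => S.gammaProd I.1).prod v) w =
      ((l.map (indexSign p q)).prod : ℂ) *
        inner ℂ v ((l.map fun I => S.gammaProd I.1).reverse.prod w) := by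
  induction l generalizing v w with
  | nil => simp
  | cons I l ih =>
    rw [List.map_cons, List.prod_cons, Module.End.mul_apply, inner_gammaProd, ih, List.map_cons,
      List.prod_cons, List.reverse_cons, List.prod_append]
    simp [mul_assoc]

/-- The trace of an adjoint is the conjugate of the trace, and the adjoint reverses the product of
the `Γ^{I_j}`. -/
theorem star_bracket [FiniteDimensional ℂ V] (S : SpinorModule p q V) {m : ℕ}
    (I : Fin m → OddIndex (p + q)) :
    star (S.bracket I) =
      ((∏ j, indexSign p q (I j) : ℤ) : ℂ) * S.bracket (fun j => I j.rev) := by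
  have hl : (List.ofFn fun j => S.gammaProd (I j).1) =
      (List.ofFn I).map fun I => S.gammaProd I.1 := by rw [List.map_ofFn]; rfl
  have hr : (List.ofFn fun j => S.gammaProd (I j.rev).1) =
      ((List.ofFn I).map fun I => S.gammaProd I.1).reverse := by
    rw [List.map_ofFn, List.ofFn_reverse_eq]; rfl
  have he : (∏ j, indexSign p q (I j)) = ((List.ofFn I).map (indexSign p q)).prod := by
    rw [List.map_ofFn, List.prod_ofFn]; rfl
  rw [bracket, bracket, hl, hr, he, star_div₀, ← mul_div_assoc]
  congr 1
  · rw [LinearMap.trace_eq_sum_inner _ (stdOrthonormalBasis ℂ V),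
      LinearMap.trace_eq_sum_inner _ (stdOrthonormalBasis ℂ V), star_sum, Finset.mul_sum]
    refine Finset.sum_congr rfl fun i _ => ?_
    rw [← inner_gammaProd_list]
    exact inner_conj_symm _ _
  · simp

end SpinorModule

end FuzzyGeom

/-! ### The trace of a power of the Dirac operator -/

theorem Finset.sum_pow_eq_sum_ofFn {X R : Type*} [Fintype X] [Semiring R] (a : X → R) (m : ℕ) :
    (∑ x, a x) ^ m = ∑ I : Fin m → X, (List.ofFn fun j => a (I j)).prod := by
  induction m with
  | zero => simp
  | succ m ih =>
    rw [pow_succ', ih, Finset.sum_mul_sum, ← (Fin.consEquiv fun _ => X).sum_comp,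
      Fintype.sum_prod_type]
    simp [Fin.consEquiv]

/-- Distributivity for an ordered product of sums `A j + B j`, where the `A i` commute with the
`B j`. -/
theorem List.prod_map_add_eq_sum {ι R : Type*} [DecidableEq ι] [Semiring R] (A B : ι → R)
    (h : ∀ i j, Commute (A i) (B j)) {l : List ι} (hl : l.Nodup) :
    (l.map fun j => A j + B j).prod = ∑ Y ∈ l.toFinset.powerset,
      ((l.filter (· ∉ Y)).map A).prod * ((l.filter (· ∈ Y)).map B).prod := by
  induction l with
  | nil => simp
  | cons i l ih =>
    obtain ⟨h1, h2⟩ := List.nodup_cons.1 hl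
    have hi : i ∉ l.toFinset := by simpa using h1
    rw [List.map_cons, List.prod_cons, ih h2, List.toFinset_cons, Finset.sum_powerset_insert hi,
      add_mul, Finset.mul_sum, Finset.mul_sum]
    congr 1
    · refine Finset.sum_congr rfl fun Y hY => ?_
      have hiY : i ∉ Y := fun hiY => hi (Finset.mem_powerset.1 hY hiY)
      simp [hiY, mul_assoc]
    · refine Finset.sum_congr rfl fun Y hY => ?_
      have e1 : l.filter (· ∉ insert i Y) = l.filter (· ∉ Y) :=
        List.filter_congr fun j hj => by
          have : j ≠ i := fun hji => h1 (hji ▸ hj)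
          simp [this]
      have e2 : l.filter (· ∈ insert i Y) = l.filter (· ∈ Y) :=
        List.filter_congr fun j hj => by
          have : j ≠ i := fun hji => h1 (hji ▸ hj)
          simp [this]
      rw [List.filter_cons_of_neg (by simp), List.filter_cons_of_pos (by simp), e1, e2,
        List.map_cons, List.prod_cons, ← mul_assoc, ← mul_assoc]
      congr 1
      exact (Commute.list_prod_left _ _ fun x hx => by
        obtain ⟨j, _, rfl⟩ := List.mem_map.1 hx
        exact h j i).eq.symm

theorem Matrix.trace_mulLeft_mul_mulRight {n : Type*} [Fintype n] [DecidableEq n]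
    (A B : Matrix n n ℂ) :
    LinearMap.trace ℂ (Matrix n n ℂ) (LinearMap.mulLeft ℂ A * LinearMap.mulRight ℂ B) =
      A.trace * B.trace := by
  rw [LinearMap.trace_eq_matrix_trace ℂ (Matrix.stdBasis ℂ n n), Matrix.trace,
    Fintype.sum_prod_type, Matrix.trace, Matrix.trace, Finset.sum_mul_sum]
  refine Finset.sum_congr rfl fun i _ => Finset.sum_congr rfl fun j _ => ?_
  rw [Matrix.diag_apply, LinearMap.toMatrix_apply, Matrix.stdBasis_eq_single]
  have (M : Matrix n n ℂ) : (Matrix.stdBasis ℂ n n).repr M (i, j) = M i j := by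
    simp [Matrix.stdBasis]
  rw [this]
  simp [Matrix.mul_apply, Matrix.single_apply, ite_and, Finset.sum_ite_eq]

namespace FuzzyGeom

variable {p q N : ℕ} {V : Type*} [NormedAddCommGroup V] [InnerProductSpace ℂ V]

theorem orderedProd_eq {m : ℕ} (Y : Finset (Fin m)) (M : Fin m → Matrix (Fin N) (Fin N) ℂ) :
    orderedProd Y M = (((List.finRange m).filter (· ∈ Y)).map M).prod := by
  rw [orderedProd]
  congr 2
  refine List.Perm.eq_of_pairwise (le := (· ≤ ·)) (fun _ _ _ _ => le_antisymm)
    (Finset.pairwise_sort _ _) ?_ ?_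
  · exact ((List.pairwise_lt_finRange m).imp le_of_lt).filter _
  · exact (List.perm_ext_iff_of_nodup (Finset.sort_nodup _ _)
      ((List.nodup_finRange m).filter _)).2 (by simp)

theorem trace_orderedProd_transpose {m : ℕ} (Y : Finset (Fin m))
    (M : Fin m → Matrix (Fin N) (Fin N) ℂ) :
    (orderedProd Y fun j => (M j).transpose).trace =
      (((List.finRange m).filter (· ∈ Y)).map M).reverse.prod.trace := by
  rw [orderedProd_eq, ← Matrix.trace_transpose, Matrix.transpose_list_prod, List.map_map]
  simp [Function.comp_def]

theorem prod_map_mulRight {ι : Type*} (l : List ι) (e : ι → ℤ)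
    (K : ι → Matrix (Fin N) (Fin N) ℂ) :
    (l.map fun j => e j • LinearMap.mulRight ℂ (K j)).prod =
      (l.map e).prod • LinearMap.mulRight ℂ (l.map K).reverse.prod := by
  induction l with
  | nil => ext1 R; simp
  | cons j l ih =>
    rw [List.map_cons, List.prod_cons, ih, smul_mul_smul_comm, List.map_cons, List.prod_cons,
      List.map_cons, List.reverse_cons, List.prod_append, List.prod_singleton,
      LinearMap.mulRight_mul]
    rfl

/-- `Y` is the set of the positions at which the matrix acts by right multiplication. The right
multiplications compose in the opposite order, hence the transposes. -/
theorem trace_prod_letterOp {m : ℕ} (e : Fin m → ℤ) (K : Fin m → Matrix (Fin N) (Fin N) ℂ) :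
    LinearMap.trace ℂ _ (List.ofFn fun j => letterOp (e j) (K j)).prod =
      ∑ Y : Finset (Fin m), ((∏ j ∈ Y, e j : ℤ) : ℂ) * (orderedProd Yᶜ K).trace *
        (orderedProd Y fun j => (K j).transpose).trace := by
  have h := List.prod_map_add_eq_sum (fun j => LinearMap.mulLeft ℂ (K j))
    (fun j => e j • LinearMap.mulRight ℂ (K j))
    (fun i j => Commute.smul_right (LinearMap.commute_mulLeft_right (K i) (K j)) (e j))
    (List.nodup_finRange m)
  rw [List.ofFn_eq_map]
  simp only [letterOp]
  rw [h, map_sum]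
  simp only [List.toFinset_finRange, Finset.powerset_univ]
  refine Finset.sum_congr rfl fun Y _ => ?_
  have hL : (((List.finRange m).filter (· ∉ Y)).map fun j => LinearMap.mulLeft ℂ (K j)).prod =
      LinearMap.mulLeft ℂ (orderedProd Yᶜ K) := by
    rw [orderedProd_eq]
    simp only [Finset.mem_compl]
    exact ((map_list_prod (Algebra.lmul ℂ (Matrix (Fin N) (Fin N) ℂ)) _).trans
      (by rw [List.map_map]; rfl)).symm
  have hE : (((List.finRange m).filter (· ∈ Y)).map e).prod = ∏ j ∈ Y, e j := by
    rw [← List.prod_toFinset _ ((List.nodup_finRange m).filter _)]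
    congr 1
    ext; simp
  rw [hL, prod_map_mulRight, mul_smul_comm, map_zsmul, Matrix.trace_mulLeft_mul_mulRight,
    trace_orderedProd_transpose, hE,
    zsmul_eq_mul, mul_assoc]

theorem prod_map_tensorMap {M : Type*} [AddCommGroup M] [Module ℂ M] {ι : Type*} (l : List ι)
    (S : ι → Module.End ℂ V) (T : ι → Module.End ℂ M) :
    (l.map fun j => TensorProduct.map (S j) (T j)).prod =
      TensorProduct.map (l.map S).prod (l.map T).prod := by
  induction l with
  | nil => exact TensorProduct.map_id.symm
  | cons j l ih => simp [ih, TensorProduct.map_mul]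

/-- The trace of a power of the Dirac operator. The subsets `∅` and `univ` of the expansion of
`k_{I_1} ⋯ k_{I_m}` give the single-trace functional, with a factor `N = Tr 1`. -/
theorem FuzzyGeometry.trace_pow_D [FiniteDimensional ℂ V] (G : FuzzyGeometry p q N V)
    {K : OddIndex (p + q) → Matrix (Fin N) (Fin N) ℂ} (hK : G.IsParametrizedBy K) {m : ℕ}
    (hm : m ≠ 0) :
    LinearMap.trace ℂ (HilbertSpace N V) (G.D ^ m) = (Module.finrank ℂ V : ℂ) *
      (N * singleTrace G.toSpinorModule K m + biTrace G.toSpinorModule K m) := by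
  have := G.nontrivial
  have h0 : (Module.finrank ℂ V : ℂ) ≠ 0 := by
    exact_mod_cast (Module.finrank_pos (R := ℂ) (M := V)).ne'
  rw [hK.2, Finset.sum_pow_eq_sum_ofFn, map_sum, singleTrace, biTrace, Finset.mul_sum,
    ← Finset.sum_add_distrib, Finset.mul_sum]
  refine Finset.sum_congr rfl fun I _ => ?_
  rw [List.ofFn_eq_map, prod_map_tensorMap, LinearMap.trace_tensorProduct', ← List.ofFn_eq_map,
    ← List.ofFn_eq_map, trace_prod_letterOp]
  have hb : LinearMap.trace ℂ V (List.ofFn fun j => G.gammaProd (I j).1).prod =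
      (Module.finrank ℂ V : ℂ) * G.bracket I := by
    rw [SpinorModule.bracket, mul_div_cancel₀ _ h0]
  have hne : (∅ : Finset (Fin m)) ≠ Finset.univ := by
    have : NeZero m := ⟨hm⟩
    exact Finset.univ_nonempty.ne_empty.symm
  have hmem (Y : Finset (Fin m)) : Y ∈ ({∅, Finset.univ} : Finset (Finset (Fin m))) ↔
      ¬ (Y ≠ ∅ ∧ Yᶜ ≠ ∅) := by
    simp only [Finset.mem_insert, Finset.mem_singleton, ne_eq, Finset.compl_eq_empty_iff]
    tauto
  rw [hb, ← Finset.sum_filter_add_sum_filter_not Finset.univ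
      (fun Y : Finset (Fin m) => Y ≠ ∅ ∧ Yᶜ ≠ ∅),
    show (Finset.univ.filter fun Y : Finset (Fin m) => ¬ (Y ≠ ∅ ∧ Yᶜ ≠ ∅)) = {∅, Finset.univ} by
      ext Y; rw [hmem]; simp,
    Finset.sum_pair hne]
  have h1 : (orderedProd Finset.univ fun j => K (I j)) = (List.ofFn fun j => K (I j)).prod := by
    rw [orderedProd_eq, List.ofFn_eq_map]; simp
  have h2 : (orderedProd Finset.univ fun j => (K (I j)).transpose).trace =
      (List.ofFn fun j => K (I j)).reverse.prod.trace := by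
    rw [trace_orderedProd_transpose, List.ofFn_eq_map]; simp
  have h3 (M : Fin m → Matrix (Fin N) (Fin N) ℂ) : orderedProd ∅ M = 1 := by simp [orderedProd]
  simp only [Finset.compl_empty, Finset.compl_univ, h1, h2, h3, Matrix.trace_one, Finset.prod_empty,
    Fintype.card_fin, Int.cast_one]
  ring

theorem FuzzyGeometry.spectralAction_eq [FiniteDimensional ℂ V] (G : FuzzyGeometry p q N V)
    {K : OddIndex (p + q) → Matrix (Fin N) (Fin N) ℂ} (hK : G.IsParametrizedBy K)
    {f : Polynomial ℝ} (hf0 : f.coeff 0 = 0) :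
    G.spectralAction f = (Module.finrank ℂ V : ℂ) *
      (N * singleTracePoly G.toSpinorModule K f + biTracePoly G.toSpinorModule K f) := by
  rw [spectralAction, Polynomial.aeval_def, Polynomial.eval₂_map, Polynomial.eval₂_eq_sum,
    Polynomial.sum, map_sum, singleTracePoly, biTracePoly, Finset.mul_sum,
    ← Finset.sum_add_distrib, Finset.mul_sum]
  refine Finset.sum_congr rfl fun m hm => ?_
  have hm0 : m ≠ 0 := by
    rintro rfl
    exact Polynomial.mem_support_iff.1 hm hf0
  rw [RingHom.comp_apply, Algebra.algebraMap_eq_smul_one (A := Module.End ℂ _), smul_mul_assoc,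
    one_mul, map_smul, G.trace_pow_D hK hm0, Complex.coe_algebraMap, smul_eq_mul]
  ring

end FuzzyGeom

/-! ### Existence of the parametrizing matrices -/

/-- The coefficients of linearly independent operators are determined by the action on pure tensors.
They are vectors here rather than operators, so that this applies also to antilinear
expressions. -/
theorem LinearIndependent.eq_zero_of_sum_apply_tmul_eq_zero {ι V M : Type*} [Fintype ι]
    [AddCommGroup V] [Module ℂ V] [AddCommGroup M] [Module ℂ M] {Γ : ι → Module.End ℂ V}
    (hΓ : LinearIndependent ℂ Γ) {Y : ι → M} (h : ∀ v, ∑ i, Γ i v ⊗ₜ[ℂ] Y i = 0) (i : ι) :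
    Y i = 0 := by
  refine (Module.forall_dual_apply_eq_zero_iff ℂ (Y i)).1 fun φ => ?_
  refine Fintype.linearIndependent_iff.1 hΓ (fun j => φ (Y j)) (LinearMap.ext fun v => ?_) i
  simpa using congrArg (fun x => TensorProduct.rid ℂ V (φ.lTensor V x)) (h v)

theorem LinearIndependent.eq_zero_of_sum_map_eq_zero {ι V M : Type*} [Fintype ι]
    [AddCommGroup V] [Module ℂ V] [AddCommGroup M] [Module ℂ M] {Γ : ι → Module.End ℂ V}
    (hΓ : LinearIndependent ℂ Γ) {X : ι → Module.End ℂ M}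
    (h : ∑ i, TensorProduct.map (Γ i) (X i) = 0) (i : ι) : X i = 0 := by
  refine LinearMap.ext fun R => hΓ.eq_zero_of_sum_apply_tmul_eq_zero (Y := fun i => X i R)
    (fun v => ?_) i
  simpa using congrArg (fun T => T (v ⊗ₜ R)) h

/-- An operator on matrices whose commutators with left multiplications commute with right
multiplications is the sum of a left and a right multiplication: it differs by a right
multiplication from a derivation, and derivations of a matrix algebra are inner. -/
theorem Matrix.exists_eq_mulLeft_add_mulRight {n : Type*} [Fintype n] [DecidableEq n]
    {X : Module.End ℂ (Matrix n n ℂ)}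
    (hX : ∀ a b : Matrix n n ℂ, Commute ⁅X, LinearMap.mulLeft ℂ a⁆ (LinearMap.mulRight ℂ b)) :
    ∃ A B : Matrix n n ℂ, X = LinearMap.mulLeft ℂ A + LinearMap.mulRight ℂ B := by
  rcases isEmpty_or_nonempty n with hn | ⟨⟨o⟩⟩
  · exact ⟨0, 0, LinearMap.ext fun R => Subsingleton.elim _ _⟩
  have hmul (a b) : X (a * b) = X a * b + a * X b - a * X 1 * b := by
    have h := congrArg (fun T => T 1) (hX a b).eq
    simp only [Module.End.mul_apply, LinearMap.mulRight_apply, LinearMap.mulLeft_apply,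
      Ring.lie_def, LinearMap.sub_apply, one_mul, mul_one, sub_mul] at h
    rw [sub_eq_iff_eq_add] at h
    rw [h]; abel
  set A : Matrix n n ℂ := ∑ i, (X (Matrix.single i o 1) - Matrix.single i o 1 * X 1) *
    Matrix.single o i 1 with hA
  refine ⟨A, X 1 - A, LinearMap.ext fun a => ?_⟩
  have hunit : ∑ i : n, Matrix.single i o (1 : ℂ) * Matrix.single o i 1 = 1 := by
    ext k l
    simp [Matrix.sum_apply, Matrix.single_apply, Matrix.one_apply, ite_and]
  have hcol (i : n) : a * Matrix.single i o 1 = ∑ k, a k i • Matrix.single k o (1 : ℂ) := by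
    ext k l
    simp [Matrix.sum_apply, Matrix.mul_apply, Matrix.single_apply, ite_and]
  have hrow (k : n) : Matrix.single o k 1 * a = ∑ i, a k i • Matrix.single o i (1 : ℂ) := by
    ext i l
    simp [Matrix.sum_apply, Matrix.mul_apply, Matrix.single_apply, ite_and]
  -- the derivation `Y = X - (· * X 1)` is `[A, ·]`, since `A = ∑ i, Y (E i o) * E o i`
  have h1 : A * a = ∑ i, (X (a * Matrix.single i o 1) - a * Matrix.single i o 1 * X 1) *
      Matrix.single o i 1 := by
    simp only [hA, Finset.sum_mul, mul_assoc _ _ a, hrow, hcol, map_sum, map_smul, Finset.mul_sum,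
      ← Finset.sum_sub_distrib, smul_mul_assoc, mul_smul_comm, ← smul_sub]
    exact Finset.sum_comm
  have h2 : A * a = X a - a * X 1 + a * A := by
    have h3 (i : n) : (X (a * Matrix.single i o 1) - a * Matrix.single i o 1 * X 1) *
        Matrix.single o i 1 = (X a - a * X 1) * (Matrix.single i o 1 * Matrix.single o i 1) +
        a * ((X (Matrix.single i o 1) - Matrix.single i o 1 * X 1) * Matrix.single o i 1) := by
      rw [hmul]; noncomm_ring
    rw [h1, Finset.sum_congr rfl fun i _ => h3 i, Finset.sum_add_distrib, ← Finset.mul_sum, hunit,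
      ← Finset.mul_sum, mul_one]
  simp only [LinearMap.add_apply, LinearMap.mulLeft_apply, LinearMap.mulRight_apply, h2, mul_sub]
  abel

namespace FuzzyGeom

theorem indexSign_mul_self {p q : ℕ} (I : OddIndex (p + q)) :
    indexSign p q I * indexSign p q I = 1 := by
  rw [indexSign, ← mul_pow]; simp

theorem koEps'_mul_self (s : ZMod 8) : koEps' s * koEps' s = 1 := by
  revert s; decide

variable {p q N : ℕ} {V : Type*} [NormedAddCommGroup V] [InnerProductSpace ℂ V]

namespace SpinorModule

theorem prod_gamma_mul_gammaProd_univ (hd : Even (p + q)) (S : SpinorModule p q V)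
    (l : List (Fin (p + q))) :
    (l.map S.gamma).prod * S.gammaProd Finset.univ =
      (-1 : ℂ) ^ l.length • (S.gammaProd Finset.univ * (l.map S.gamma).prod) := by
  induction l with
  | nil => simp
  | cons μ l ih =>
    rw [List.map_cons, List.prod_cons, mul_assoc, ih, mul_smul_comm, ← mul_assoc,
      gamma_mul_gammaProd, if_pos (Finset.mem_univ _), Finset.card_fin, smul_mul_assoc, smul_smul,
      List.length_cons, pow_succ _ (p + q), hd.neg_one_pow, pow_succ, one_mul, mul_assoc]

end SpinorModule

namespace FuzzyGeometry

theorem exists_D_eq_sum [FiniteDimensional ℂ V] (G : FuzzyGeometry p q N V) :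
    ∃ X : Finset (Fin (p + q)) → Module.End ℂ (Matrix (Fin N) (Fin N) ℂ),
      G.D = ∑ J, TensorProduct.map (G.gammaProd J) (X J) := by
  obtain ⟨t, ht⟩ := (homTensorHomEquiv ℂ V (Matrix (Fin N) (Fin N) ℂ) V
    (Matrix (Fin N) (Fin N) ℂ)).surjective G.D
  rw [homTensorHomEquiv_apply] at ht
  rw [← ht]
  clear ht
  induction t with
  | zero => exact ⟨0, by simp⟩
  | tmul T Y =>
    have hT : T ∈ Submodule.span ℂ (Set.range G.gammaProd) := G.span_gammaProd ▸ trivial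
    obtain ⟨a, rfl⟩ := (Submodule.mem_span_range_iff_exists_fun ℂ).1 hT
    refine ⟨fun J => a J • Y, ?_⟩
    simp [TensorProduct.sum_tmul, TensorProduct.map_smul_right,
      TensorProduct.smul_tmul]
  | add t t' h h' =>
    obtain ⟨X, hX⟩ := h
    obtain ⟨X', hX'⟩ := h'
    exact ⟨X + X', by simp [hX, hX', TensorProduct.map_add_right, Finset.sum_add_distrib]⟩

/-- Only odd products of gamma matrices occur in the Dirac operator, since it anticommutes with the
chirality. -/
theorem exists_D_eq_sum_odd (hd : Even (p + q)) [FiniteDimensional ℂ V]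
    (G : FuzzyGeometry p q N V) :
    ∃ X : OddIndex (p + q) → Module.End ℂ (Matrix (Fin N) (Fin N) ℂ),
      G.D = ∑ I : OddIndex (p + q), TensorProduct.map (G.gammaProd I.1) (X I) := by
  obtain ⟨X, hX⟩ := G.exists_D_eq_sum
  suffices h : ∀ J, ¬ Odd J.card → X J = 0 by
    refine ⟨fun I => X I.1, ?_⟩
    rw [hX, ← Fintype.sum_subtype_add_sum_subtype (fun J : Finset (Fin (p + q)) => Odd J.card)]
    simp only [add_eq_left]
    exact Finset.sum_eq_zero fun J _ => by rw [h J.1 J.2, TensorProduct.map_zero_right]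
  intro J hJ
  obtain ⟨s, hs, hsq⟩ := G.gammaProd_mul_self Finset.univ
  have hI : (-Complex.I) ^ ((((q : ℤ) - p) * ((q : ℤ) - p - 1)) / 2) ≠ 0 :=
    zpow_ne_zero _ (neg_ne_zero.2 Complex.I_ne_zero)
  have hcomm (J : Finset (Fin (p + q))) : G.gammaProd J * G.gammaProd Finset.univ =
      (-1 : ℂ) ^ J.card • (G.gammaProd Finset.univ * G.gammaProd J) := by
    have := G.prod_gamma_mul_gammaProd_univ hd (J.sort (· ≤ ·))
    rwa [Finset.length_sort] at this
  have h := G.D_chirality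
  rw [SpinorModule.chirality, TensorProduct.map_smul_left, mul_smul_comm, smul_mul_assoc] at h
  replace h := smul_right_injective _ hI (h.trans (smul_neg _ _).symm)
  -- the anticommutation relation, multiplied by `Γ^univ` on the left
  have h1 : TensorProduct.map (G.gammaProd Finset.univ) LinearMap.id *
        (G.D * TensorProduct.map (G.gammaProd Finset.univ) LinearMap.id) +
      TensorProduct.map (G.gammaProd Finset.univ) LinearMap.id *
        (TensorProduct.map (G.gammaProd Finset.univ) LinearMap.id * G.D) = 0 := by
    rw [← mul_add, eq_neg_iff_add_eq_zero.1 h, mul_zero]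
  rw [hX, Finset.sum_mul, Finset.mul_sum, Finset.mul_sum,
    Finset.mul_sum, ← Finset.sum_add_distrib] at h1
  have h2 (J : Finset (Fin (p + q))) :
      TensorProduct.map (G.gammaProd Finset.univ) LinearMap.id *
          (TensorProduct.map (G.gammaProd J) (X J) *
            TensorProduct.map (G.gammaProd Finset.univ) LinearMap.id) +
        TensorProduct.map (G.gammaProd Finset.univ) LinearMap.id *
          (TensorProduct.map (G.gammaProd Finset.univ) LinearMap.id *
            TensorProduct.map (G.gammaProd J) (X J)) =
      TensorProduct.map (G.gammaProd J) ((s * ((-1) ^ J.card + 1)) • X J) := by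
    simp only [← TensorProduct.map_mul, hcomm J, mul_smul_comm, ← mul_assoc, hsq, smul_mul_assoc,
      one_mul, TensorProduct.map_smul_left, TensorProduct.map_smul_right,
      ← Module.End.one_eq_id, mul_one, smul_smul, ← add_smul]
    congr 1; ring
  simp only [h2] at h1
  have h3 := (G.linearIndependent_gammaProd hd).eq_zero_of_sum_map_eq_zero h1 J
  rw [(Nat.not_odd_iff_even.1 hJ).neg_one_pow] at h3
  exact (smul_eq_zero.1 h3).resolve_left (mul_ne_zero hs (by norm_num))

/-- `J ρ(b) J⁻¹` is the right multiplication by `b^*`. -/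
theorem realStructure_leftRep_symm (C : V ≃ₗᵢ⋆[ℂ] V) (b : Matrix (Fin N) (Fin N) ℂ)
    (x : HilbertSpace N V) :
    realStructure N C (leftRep b ((realStructure N C).symm x)) =
      TensorProduct.map LinearMap.id (LinearMap.mulRight ℂ b.conjTranspose) x := by
  obtain ⟨y, rfl⟩ := (realStructure N C).surjective x
  rw [LinearEquiv.symm_apply_apply]
  induction y using TensorProduct.induction_on with
  | zero => simp
  | tmul v R => simp [leftRep, realStructure_tmul, Matrix.conjTranspose_mul]
  | add y y' h h' => simp only [map_add, h, h']

/-- The coefficient of `Γ^I` inherits the order-one condition, hence is the sum of a left and a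
right multiplication. -/
theorem exists_D_eq_sum_mulLeft_add_mulRight (hd : Even (p + q)) [FiniteDimensional ℂ V]
    (G : FuzzyGeometry p q N V) :
    ∃ A B : OddIndex (p + q) → Matrix (Fin N) (Fin N) ℂ,
      G.D = ∑ I : OddIndex (p + q), TensorProduct.map (G.gammaProd I.1)
        (LinearMap.mulLeft ℂ (A I) + LinearMap.mulRight ℂ (B I)) := by
  obtain ⟨X, hX⟩ := G.exists_D_eq_sum_odd hd
  have key (I) : ∃ A B : Matrix (Fin N) (Fin N) ℂ,
      X I = LinearMap.mulLeft ℂ A + LinearMap.mulRight ℂ B := by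
    refine Matrix.exists_eq_mulLeft_add_mulRight fun a b => ?_
    have h : ⁅⁅G.D, (leftRep a : Module.End ℂ (HilbertSpace N V))⁆,
        TensorProduct.map (LinearMap.id : V →ₗ[ℂ] V) (LinearMap.mulRight ℂ b)⁆ = 0 := by
      rw [Ring.lie_def, sub_eq_zero]
      refine LinearMap.ext fun x => ?_
      have := G.orderOne a b.conjTranspose x
      rw [realStructure_leftRep_symm, realStructure_leftRep_symm,
        Matrix.conjTranspose_conjTranspose] at this
      exact this
    have hs : ⁅⁅G.D, (leftRep a : Module.End ℂ (HilbertSpace N V))⁆,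
          TensorProduct.map (LinearMap.id : V →ₗ[ℂ] V) (LinearMap.mulRight ℂ b)⁆ =
        ∑ I : OddIndex (p + q), TensorProduct.map (G.gammaProd I.1)
          ⁅⁅X I, LinearMap.mulLeft ℂ a⁆, LinearMap.mulRight ℂ b⁆ := by
      rw [hX]
      simp only [Ring.lie_def, Finset.sum_mul, Finset.mul_sum, ← Finset.sum_sub_distrib]
      refine Finset.sum_congr rfl fun I _ => ?_
      simp only [leftRep, ← TensorProduct.map_mul, sub_mul, mul_sub,
        ← Module.End.one_eq_id, mul_one, one_mul]
      exact TensorProduct.ext' fun v R => by simp [TensorProduct.tmul_sub]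
    exact commute_iff_lie_eq.2 (((G.linearIndependent_gammaProd hd).comp _
      Subtype.val_injective).eq_zero_of_sum_map_eq_zero (hs.symm.trans h) I)
  choose A B hAB using key
  exact ⟨A, B, by simp only [hX, hAB]⟩

/-- `C` commutes with odd products up to the same sign `ε'` as with a single gamma matrix. -/
theorem C_gammaProd (G : FuzzyGeometry p q N V) (I : OddIndex (p + q)) (v : V) :
    G.C (G.gammaProd I.1 v) = koEps' (koDim p q) • G.gammaProd I.1 (G.C v) := by
  have h (l : List (Fin (p + q))) (v : V) : G.C ((l.map G.gamma).prod v) =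
      koEps' (koDim p q) ^ l.length • (l.map G.gamma).prod (G.C v) := by
    induction l generalizing v with
    | nil => simp
    | cons μ l ih =>
      rw [List.map_cons, List.prod_cons, Module.End.mul_apply, G.C_gamma, ih, List.length_cons,
        pow_succ', mul_smul, map_zsmul]
      rfl
  have h1 := h (I.1.sort (· ≤ ·)) v
  obtain ⟨k, hk⟩ := I.2
  rw [Finset.length_sort, hk, pow_succ, pow_mul, pow_two, koEps'_mul_self, one_pow, one_mul] at h1
  exact h1

/-- Self-adjointness and reality give four expressions of the coefficient of `Γ^I` as a sum of a
left and a right multiplication; their average has the required form. -/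
theorem exists_isParametrizedBy (hd : Even (p + q)) [FiniteDimensional ℂ V]
    (G : FuzzyGeometry p q N V) : ∃ K, G.IsParametrizedBy K := by
  obtain ⟨A, B, hD⟩ := G.exists_D_eq_sum_mulLeft_add_mulRight hd
  have hli : LinearIndependent ℂ fun I : OddIndex (p + q) => G.gammaProd I.1 :=
    (G.linearIndependent_gammaProd hd).comp _ Subtype.val_injective
  have hDtmul (v : V) (R : Matrix (Fin N) (Fin N) ℂ) : G.D (v ⊗ₜ R) =
      ∑ I : OddIndex (p + q), G.gammaProd I.1 v ⊗ₜ (A I * R + R * B I) := by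
    simp [hD]
  -- the reality condition
  have hreal (I) (R : Matrix (Fin N) (Fin N) ℂ) :
      R * (A I).conjTranspose + (B I).conjTranspose * R = A I * R + R * B I := by
    refine sub_eq_zero.1 (hli.eq_zero_of_sum_apply_tmul_eq_zero (Y := fun I =>
      R * (A I).conjTranspose + (B I).conjTranspose * R - (A I * R + R * B I)) (fun v => ?_) I)
    have h := G.J_D (G.C.symm v ⊗ₜ R.conjTranspose)
    rw [hDtmul, map_sum, realStructure_tmul, LinearIsometryEquiv.apply_symm_apply,
      Matrix.conjTranspose_conjTranspose, hDtmul] at h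
    simp only [realStructure_tmul, C_gammaProd, LinearIsometryEquiv.apply_symm_apply,
      ← TensorProduct.smul_tmul', ← Finset.smul_sum, Matrix.conjTranspose_add,
      Matrix.conjTranspose_mul, Matrix.conjTranspose_conjTranspose] at h
    have h2 := congrArg (fun x => koEps' (koDim p q) • x) h
    simp only [smul_smul, koEps'_mul_self, one_smul] at h2
    simp only [TensorProduct.tmul_sub, Finset.sum_sub_distrib, h2, sub_self]
  -- self-adjointness
  have hself (I) (R : Matrix (Fin N) (Fin N) ℂ) :
      indexSign p q I • ((A I).conjTranspose * R + R * (B I).conjTranspose) =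
        A I * R + R * B I := by
    refine Matrix.ext_iff_trace_mul_left.2 fun S => ?_
    have hv : ∑ I : OddIndex (p + q),
        ((S * (indexSign p q I • ((A I).conjTranspose * R + R * (B I).conjTranspose))).trace -
          (S * (A I * R + R * B I)).trace) • G.gammaProd I.1 = 0 := by
      refine LinearMap.ext fun w => ext_inner_left ℂ fun v => ?_
      have h := G.selfAdjoint (v ⊗ₜ S.conjTranspose) (w ⊗ₜ R)
      rw [hDtmul, hDtmul, map_sum, map_sum, LinearMap.sum_apply] at h
      simp only [hilbertForm_tmul, G.inner_gammaProd] at h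
      rw [← sub_eq_zero, ← Finset.sum_sub_distrib] at h
      simp only [LinearMap.sum_apply, LinearMap.smul_apply, inner_sum, inner_smul_right,
        LinearMap.zero_apply, inner_zero_right]
      rw [← h]
      refine Finset.sum_congr rfl fun I _ => ?_
      simp only [Matrix.conjTranspose_add, Matrix.conjTranspose_mul,
        Matrix.conjTranspose_conjTranspose, mul_smul_comm, Matrix.trace_smul,
        add_mul, mul_add, Matrix.trace_add, smul_add]
      rw [Matrix.trace_mul_comm ((B I).conjTranspose * S) R, ← Matrix.mul_assoc R,
        Matrix.trace_mul_comm _ S]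
      simp only [Matrix.mul_assoc, zsmul_eq_mul]
      ring
    exact sub_eq_zero.1 (Fintype.linearIndependent_iff.1 hli _ hv I)
  refine ⟨fun I => (4 : ℂ)⁻¹ • (A I + indexSign p q I • (A I).conjTranspose +
    (B I).conjTranspose + indexSign p q I • B I), fun I => ?_, ?_⟩
  · simp only [Matrix.conjTranspose_smul, Matrix.conjTranspose_add,
      Matrix.conjTranspose_conjTranspose, smul_add, smul_smul, indexSign_mul_self,
      smul_comm (indexSign p q I) (4⁻¹ : ℂ), one_smul]
    simp
    abel
  · rw [hD]
    refine Finset.sum_congr rfl fun I _ => congrArg _ (LinearMap.ext fun R => ?_)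
    -- the average of the four expressions of the coefficient of `Γ^I`
    have h1 := hself I R
    have h2 := hreal I R
    have h3 : indexSign p q I • (R * A I + B I * R) = A I * R + R * B I := by
      have h := congrArg Matrix.conjTranspose (hself I R.conjTranspose)
      simp only [Matrix.conjTranspose_add, Matrix.conjTranspose_mul, Matrix.conjTranspose_smul,
        Matrix.conjTranspose_conjTranspose, h2] at h
      simpa using h
    calc (LinearMap.mulLeft ℂ (A I) + LinearMap.mulRight ℂ (B I)) R
        = (4 : ℂ)⁻¹ • ((A I * R + R * B I) + (A I * R + R * B I) + (A I * R + R * B I) +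
            (A I * R + R * B I)) := by
          simp only [LinearMap.add_apply, LinearMap.mulLeft_apply, LinearMap.mulRight_apply]
          module
      _ = (4 : ℂ)⁻¹ • ((A I * R + R * B I) +
            indexSign p q I • ((A I).conjTranspose * R + R * (B I).conjTranspose) +
            (R * (A I).conjTranspose + (B I).conjTranspose * R) +
            indexSign p q I • (R * A I + B I * R)) := by rw [h1, h2, h3]
      _ = _ := by
          simp only [letterOp, LinearMap.add_apply, LinearMap.smul_apply, LinearMap.mulLeft_apply,
            LinearMap.mulRight_apply, smul_mul_assoc, mul_smul_comm, add_mul, mul_add, smul_add,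
            smul_comm (indexSign p q I) (4⁻¹ : ℂ), smul_smul (indexSign p q I),
            indexSign_mul_self, one_smul]
          abel

end FuzzyGeometry

end FuzzyGeom

/-! ### Formal adjoints of noncommutative polynomials -/

namespace FuzzyGeom

section NCPolynomials

variable {X : Type*}

theorem formalAdjoint_add (e : X → ℤ) (P Q : FreeAlgebra ℝ X) :
    formalAdjoint e (P + Q) = formalAdjoint e P + formalAdjoint e Q := by
  simp [formalAdjoint]

theorem formalAdjoint_zero (e : X → ℤ) : formalAdjoint e 0 = 0 := by simp [formalAdjoint]

theorem formalAdjoint_smul (e : X → ℤ) (a : ℝ) (P : FreeAlgebra ℝ X) :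
    formalAdjoint e (a • P) = a • formalAdjoint e P := by
  simp [formalAdjoint]

theorem formalAdjoint_sum (e : X → ℤ) {ι : Type*} (s : Finset ι) (P : ι → FreeAlgebra ℝ X) :
    formalAdjoint e (∑ i ∈ s, P i) = ∑ i ∈ s, formalAdjoint e (P i) := by
  simp [formalAdjoint, map_sum]

theorem formalAdjoint_monomial (e : X → ℤ) (l : List X) :
    formalAdjoint e (monomial l) = ((l.map e).prod : ℝ) • monomial l.reverse := by
  induction l with
  | nil => simp [formalAdjoint, monomial]
  | cons x l ih =>
    have h : formalAdjoint e (monomial (x :: l)) =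
        formalAdjoint e (monomial l) * (e x • FreeAlgebra.ι ℝ x) := by
      simp [formalAdjoint, monomial]
    rw [h, ih, ← Int.cast_smul_eq_zsmul ℝ, smul_mul_smul_comm, List.reverse_cons, List.map_cons,
      List.prod_cons, Int.cast_mul, mul_comm]
    simp [monomial]

theorem monomial_eq_symm_single (l : List X) :
    monomial l = FreeAlgebra.equivMonoidAlgebraFreeMonoid.symm
      (MonoidAlgebra.single (FreeMonoid.ofList l) (1 : ℝ)) := by
  rw [AlgEquiv.eq_symm_apply, monomial, map_list_prod, List.map_map]
  induction l with
  | nil => rfl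
  | cons x l ih =>
    rw [List.map_cons, List.prod_cons, ih]
    simp [FreeAlgebra.equivMonoidAlgebraFreeMonoid, MonoidAlgebra.single_mul_single]

theorem coeff_monomial [DecidableEq (FreeMonoid X)] (l : List X) (w : FreeMonoid X) :
    coeff (monomial l) w = if FreeMonoid.ofList l = w then 1 else 0 := by
  rw [coeff, monomial_eq_symm_single, AlgEquiv.apply_symm_apply, MonoidAlgebra.coeff_single,
    Finsupp.single_apply]

theorem coeff_add (P Q : FreeAlgebra ℝ X) (w : FreeMonoid X) :
    coeff (P + Q) w = coeff P w + coeff Q w := by simp [coeff]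

theorem coeff_smul (a : ℝ) (P : FreeAlgebra ℝ X) (w : FreeMonoid X) :
    coeff (a • P) w = a * coeff P w := by simp [coeff]

theorem monomial_induction {motive : FreeAlgebra ℝ X → Prop} (P : FreeAlgebra ℝ X)
    (zero : motive 0) (add : ∀ P Q, motive P → motive Q → motive (P + Q))
    (smul_monomial : ∀ (a : ℝ) l, motive (a • monomial l)) : motive P := by
  obtain ⟨x, rfl⟩ := (FreeAlgebra.equivMonoidAlgebraFreeMonoid (R := ℝ) (X := X)).symm.surjective P
  induction x using MonoidAlgebra.induction_linear with
  | zero => simpa using zero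
  | add x y hx hy => rw [map_add]; exact add _ _ hx hy
  | single w a =>
    have := smul_monomial a (FreeMonoid.toList w)
    rwa [monomial_eq_symm_single, ← map_smul, MonoidAlgebra.smul_single, smul_eq_mul,
      mul_one] at this

/-- The coefficient of `P^*` at the reversal of a word. -/
theorem coeff_formalAdjoint_reverse (e : X → ℤ) (P : FreeAlgebra ℝ X) (w : FreeMonoid X) :
    coeff (formalAdjoint e P) (FreeMonoid.ofList w.toList.reverse) =
      ((w.toList.map e).prod : ℝ) * coeff P w := by
  classical
  induction P using monomial_induction with
  | zero => simp [formalAdjoint, coeff]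
  | add P Q hP hQ => rw [formalAdjoint_add, coeff_add, coeff_add, hP, hQ, mul_add]
  | smul_monomial a l =>
    rw [formalAdjoint_smul, formalAdjoint_monomial, coeff_smul, coeff_smul, coeff_smul,
      coeff_monomial, coeff_monomial]
    by_cases h : FreeMonoid.ofList l = w
    · subst h; simp; ring
    · have h' : FreeMonoid.ofList l.reverse ≠ FreeMonoid.ofList w.toList.reverse := fun h' =>
        h (List.reverse_injective h')
      simp [h, h']

theorem prod_map_mul_self {e : X → ℤ} (he : ∀ x, e x * e x = 1) (l : List X) :
    ((l.map e).prod : ℝ) * ((l.map e).prod : ℝ) = 1 := by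
  induction l with
  | nil => simp
  | cons x l ih =>
    have h : (e x : ℝ) * e x = 1 := by exact_mod_cast he x
    rw [List.map_cons, List.prod_cons, Int.cast_mul, mul_mul_mul_comm, h, ih, one_mul]

/-- A polynomial with `P^* = s P` satisfies the cyclic condition: the bijection of its words is the
reversal, and the rotations are trivial. -/
theorem isCyclicAdjointUpTo_of_formalAdjoint_eq {s : ℝ} {e : X → ℤ}
    (he : ∀ x, e x * e x = 1) {P : FreeAlgebra ℝ X} (hP : formalAdjoint e P = s • P) :
    IsCyclicAdjointUpTo s e P := by
  have hcoeff (w : FreeMonoid X) : ((w.toList.map e).prod : ℝ) * coeff P w =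
      s * coeff P (FreeMonoid.ofList w.toList.reverse) := by
    rw [← coeff_formalAdjoint_reverse, hP, coeff_smul]
  have hrev (w : FreeMonoid X) (hw : w ∈ words P) :
      FreeMonoid.ofList w.toList.reverse ∈ words P := fun h0 => hw <| by
    have h := hcoeff w
    rw [h0, mul_zero] at h
    rw [← one_mul (coeff P w), ← prod_map_mul_self he w.toList, mul_assoc, h, mul_zero]
  let φ : words P ≃ words P :=
    { toFun := fun w => ⟨_, hrev w.1 w.2⟩
      invFun := fun w => ⟨_, hrev w.1 w.2⟩
      left_inv := fun w => Subtype.ext (by simp)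
      right_inv := fun w => Subtype.ext (by simp) }
  refine ⟨φ, fun w => ⟨0, ?_⟩⟩
  rw [formalAdjoint_smul, formalAdjoint_monomial, smul_smul, smul_smul, mul_comm (coeff P _),
    hcoeff, List.rotate_zero]
  rfl

/-- For `s = ±1`, the polynomial `P + s P^*` equals `s` times its adjoint. -/
theorem formalAdjoint_add_smul {s : ℝ} (hs : s * s = 1) {e : X → ℤ}
    (he : ∀ x, e x * e x = 1) (P : FreeAlgebra ℝ X) :
    formalAdjoint e (P + s • formalAdjoint e P) = s • (P + s • formalAdjoint e P) := by
  have hinv : formalAdjoint e (formalAdjoint e P) = P := by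
    induction P using monomial_induction with
    | zero => simp [formalAdjoint_zero]
    | add P Q hP hQ => rw [formalAdjoint_add, formalAdjoint_add, hP, hQ]
    | smul_monomial a l =>
      rw [formalAdjoint_smul, formalAdjoint_monomial, formalAdjoint_smul, formalAdjoint_smul,
        formalAdjoint_monomial, List.map_reverse, List.prod_reverse, smul_smul _ _ (monomial _),
        prod_map_mul_self he, one_smul, List.reverse_reverse]
  rw [formalAdjoint_add, formalAdjoint_smul, hinv, smul_add, smul_smul, hs, one_smul, add_comm]

end NCPolynomials

end FuzzyGeom

/-! ### The polynomials of the single-trace and bi-trace functionals -/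

namespace FuzzyGeom

section TraceEval

variable {X : Type*} {N : ℕ} (K : X → Matrix (Fin N) (Fin N) ℂ)

theorem traceEval_add (P Q : FreeAlgebra ℝ X) :
    traceEval K (P + Q) = traceEval K P + traceEval K Q := by
  simp [traceEval]

theorem traceEval_smul (a : ℝ) (P : FreeAlgebra ℝ X) :
    traceEval K (a • P) = a * traceEval K P := by
  rw [traceEval, map_smul, Matrix.trace_smul, Complex.real_smul]; rfl

theorem traceEval_sum {ι : Type*} (s : Finset ι) (P : ι → FreeAlgebra ℝ X) :
    traceEval K (∑ i ∈ s, P i) = ∑ i ∈ s, traceEval K (P i) := by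
  simp [traceEval, Matrix.trace_sum]

theorem traceEval_monomial (l : List X) :
    traceEval K (monomial l) = (l.map K).prod.trace := by
  rw [traceEval, monomial, map_list_prod, List.map_map]
  congr 3
  ext1 x
  simp

theorem traceEval_formalAdjoint_monomial (e : X → ℤ) (l : List X) :
    traceEval K (formalAdjoint e (monomial l)) =
      ((l.map e).prod : ℂ) * (l.map K).reverse.prod.trace := by
  rw [formalAdjoint_monomial, traceEval_smul, traceEval_monomial, List.map_reverse,
    Complex.ofReal_intCast]

end TraceEval

/-- The letters of `I` at the positions in `Y`. -/
def subword {X : Type*} {m : ℕ} (I : Fin m → X) (Y : Finset (Fin m)) : List X :=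
  ((List.finRange m).filter (· ∈ Y)).map I

theorem subword_rev {X : Type*} {m : ℕ} (I : Fin m → X) (Y : Finset (Fin m)) :
    subword (fun j => I j.rev) (Fin.revPerm.finsetCongr Y) = (subword I Y).reverse := by
  rw [subword, subword, ← List.map_reverse, ← List.filter_reverse, List.finRange_reverse,
    List.filter_map, List.map_map]
  congr 1
  refine List.filter_congr fun j _ => ?_
  simp [Equiv.finsetCongr_apply, Finset.mem_map_equiv]

theorem compl_finsetCongr {α : Type*} [Fintype α] [DecidableEq α] (σ : Equiv.Perm α)
    (Y : Finset α) : (σ.finsetCongr Y)ᶜ = σ.finsetCongr Yᶜ := by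
  ext; simp [Equiv.finsetCongr_apply, Finset.mem_map_equiv]

theorem prod_map_subword {X : Type*} {m : ℕ} (I : Fin m → X) (Y : Finset (Fin m)) (e : X → ℤ) :
    ((subword I Y).map e).prod = ∏ j ∈ Y, e (I j) := by
  rw [subword, List.map_map, ← List.prod_toFinset _ ((List.nodup_finRange m).filter _)]
  refine Finset.prod_congr (by ext; simp) fun j _ => rfl

section Polynomials

variable {p q N : ℕ} {V : Type*} [NormedAddCommGroup V] [InnerProductSpace ℂ V]

/-- The term of `I` and `Y` is the product of the traces of the word on the complement of `Y` and of
the adjoint of the word on `Y`. -/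
theorem biTrace_eq (S : SpinorModule p q V) (K : OddIndex (p + q) → Matrix (Fin N) (Fin N) ℂ)
    (m : ℕ) : biTrace S K m = ∑ I : Fin m → OddIndex (p + q), S.bracket I *
      ∑ Y : Finset (Fin m) with Y ≠ ∅ ∧ Yᶜ ≠ ∅, traceEval K (monomial (subword I Yᶜ)) *
        traceEval K (formalAdjoint (indexSign p q) (monomial (subword I Y))) := by
  refine Finset.sum_congr rfl fun I _ => congrArg _ (Finset.sum_congr rfl fun Y _ => ?_)
  rw [traceEval_monomial, traceEval_formalAdjoint_monomial, prod_map_subword, orderedProd_eq,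
    trace_orderedProd_transpose, subword, subword, List.map_map, List.map_map]
  push_cast
  simp only [Function.comp_def]
  ring

/-- Reversing the order of the factors exchanges every word of the bi-trace functional with its
adjoint. -/
theorem biTrace_eq_adjoint (hd : Even (p + q)) [FiniteDimensional ℂ V] (S : SpinorModule p q V)
    (K : OddIndex (p + q) → Matrix (Fin N) (Fin N) ℂ) (m : ℕ) :
    biTrace S K m = ∑ I : Fin m → OddIndex (p + q), S.bracket I *
      ∑ Y : Finset (Fin m) with Y ≠ ∅ ∧ Yᶜ ≠ ∅,
        traceEval K (formalAdjoint (indexSign p q) (monomial (subword I Yᶜ))) *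
        traceEval K (monomial (subword I Y)) := by
  rw [biTrace_eq]
  refine (Fintype.sum_equiv (Fin.revPerm.arrowCongr (Equiv.refl _)) _ _ fun I => ?_).symm
  have hI : Fin.revPerm.arrowCongr (Equiv.refl _) I = fun j => I j.rev := rfl
  obtain ⟨r, hr⟩ := exists_bracket_eq hd I
  have hb : S.bracket I = ((∏ j, indexSign p q (I j) : ℤ) : ℂ) * S.bracket fun j => I j.rev := by
    rw [← S.star_bracket, hr V S]; simp
  rw [hI, hb, mul_comm (Int.cast _), mul_assoc, Finset.mul_sum]
  congr 1
  refine Finset.sum_equiv Fin.revPerm.finsetCongr (fun Y => ?_) fun Y _ => ?_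
  · simp only [Finset.mem_filter, Finset.mem_univ, true_and, compl_finsetCongr]
    simp [Equiv.finsetCongr_apply]
  · have hE (l : List (OddIndex (p + q))) :
        ((l.map (indexSign p q)).prod : ℂ) * ((l.map (indexSign p q)).prod : ℂ) = 1 := by
      exact_mod_cast prod_map_mul_self (indexSign_mul_self (p := p) (q := q)) l
    rw [compl_finsetCongr, subword_rev, subword_rev, traceEval_formalAdjoint_monomial,
      traceEval_formalAdjoint_monomial, traceEval_monomial, traceEval_monomial,
      ← Finset.prod_mul_prod_compl Y, ← prod_map_subword I, ← prod_map_subword I,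
      List.map_reverse, List.map_reverse, List.map_reverse, List.reverse_reverse,
      List.prod_reverse (List.map (indexSign p q) _), Int.cast_mul]
    have := hE (subword I Yᶜ)
    linear_combination (((subword I Y).map (indexSign p q)).prod : ℂ) *
      ((subword I Yᶜ).map K).reverse.prod.trace * ((subword I Y).map K).prod.trace * this

theorem singleTracePoly_eq (S : SpinorModule p q V)
    (K : OddIndex (p + q) → Matrix (Fin N) (Fin N) ℂ) (f : Polynomial ℝ)
    {β : ∀ m, (Fin m → OddIndex (p + q)) → ℝ} (hβ : ∀ m I, S.bracket I = β m I)
    {Q : FreeAlgebra ℝ (OddIndex (p + q))}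
    (hQ : Q = ∑ m ∈ f.support, ∑ I, (f.coeff m * β m I) • monomial (List.ofFn I)) :
    singleTracePoly S K f =
      traceEval K (Q + (1 : ℝ) • formalAdjoint (indexSign p q) Q) := by
  simp only [hQ, one_smul, formalAdjoint_sum, formalAdjoint_smul, ← Finset.sum_add_distrib,
    ← smul_add, traceEval_sum, traceEval_smul, traceEval_add, traceEval_monomial,
    traceEval_formalAdjoint_monomial, singleTracePoly, singleTrace, Finset.mul_sum, hβ,
    List.map_ofFn, List.prod_ofFn, Function.comp_def]
  refine Finset.sum_congr rfl fun m _ => Finset.sum_congr rfl fun I _ => ?_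
  push_cast
  ring

/-- The bi-trace functional is the mean of its two forms in `biTrace_eq` and `biTrace_eq_adjoint`,
and `u ⊗ w^* + u^* ⊗ w` is half the sum over `s = ±1` of `s (u + s u^*) ⊗ (w + s w^*)`. -/
theorem biTracePoly_eq (hd : Even (p + q)) [FiniteDimensional ℂ V] (S : SpinorModule p q V)
    (K : OddIndex (p + q) → Matrix (Fin N) (Fin N) ℂ) (f : Polynomial ℝ)
    {β : ∀ m, (Fin m → OddIndex (p + q)) → ℝ} (hβ : ∀ m I, S.bracket I = β m I) :
    biTracePoly S K f = ∑ m ∈ f.support, ∑ I : Fin m → OddIndex (p + q),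
      ∑ Y : Finset (Fin m) with Y ≠ ∅ ∧ Yᶜ ≠ ∅, ∑ s ∈ ({1, -1} : Finset ℝ),
        traceEval K ((4⁻¹ * s * f.coeff m * β m I) • (monomial (subword I Yᶜ) +
          s • formalAdjoint (indexSign p q) (monomial (subword I Yᶜ)))) *
        traceEval K (monomial (subword I Y) +
          s • formalAdjoint (indexSign p q) (monomial (subword I Y))) := by
  refine Finset.sum_congr rfl fun m _ => ?_
  rw [← mul_div_cancel_left₀ (biTrace S K m) (two_ne_zero' ℂ), two_mul]
  nth_rw 1 [biTrace_eq]
  rw [biTrace_eq_adjoint hd, ← Finset.sum_add_distrib, Finset.sum_div, Finset.mul_sum]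
  refine Finset.sum_congr rfl fun I _ => ?_
  rw [← mul_add, ← Finset.sum_add_distrib, Finset.mul_sum, Finset.sum_div, Finset.mul_sum]
  refine Finset.sum_congr rfl fun Y _ => ?_
  rw [Finset.sum_pair (by norm_num), hβ]
  simp only [traceEval_smul, traceEval_add]
  push_cast
  ring

/-- The polynomials depend on the signature and on `f` only, and represent the functionals on every
spinor module and at arbitrary matrices. -/
theorem exists_ncPolynomials_of_even (hd : Even (p + q)) (f : Polynomial ℝ) :
    ∃ (P : FreeAlgebra ℝ (OddIndex (p + q))) (n : ℕ)
      (Φ Ψ : Fin n → FreeAlgebra ℝ (OddIndex (p + q))),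
      IsCyclicSelfAdjoint (indexSign p q) P ∧
      (∀ i,
        (IsCyclicSelfAdjoint (indexSign p q) (Φ i) ∧ IsCyclicSelfAdjoint (indexSign p q) (Ψ i)) ∨
        (IsCyclicAntiSelfAdjoint (indexSign p q) (Φ i) ∧
          IsCyclicAntiSelfAdjoint (indexSign p q) (Ψ i))) ∧
      ∀ (N : ℕ) (V : Type*) [NormedAddCommGroup V] [InnerProductSpace ℂ V]
        [FiniteDimensional ℂ V] (S : SpinorModule p q V)
        (K : OddIndex (p + q) → Matrix (Fin N) (Fin N) ℂ),
        singleTracePoly S K f = traceEval K P ∧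
        biTracePoly S K f = ∑ i, traceEval K (Φ i) * traceEval K (Ψ i) := by
  -- the brackets, chosen before any spinor module is given
  choose β hβ using fun m (I : Fin m → OddIndex (p + q)) => exists_bracket_eq hd I
  have hs (s : ({1, -1} : Finset ℝ)) : (s : ℝ) = 1 ∨ (s : ℝ) = -1 := by
    simpa only [Finset.mem_insert, Finset.mem_singleton] using s.2
  have hss (s : ({1, -1} : Finset ℝ)) : (s : ℝ) * s = 1 := by
    rcases hs s with h | h <;> simp [h]
  let Q : FreeAlgebra ℝ (OddIndex (p + q)) :=
    ∑ m ∈ f.support, ∑ I, (f.coeff m * β m I) • monomial (List.ofFn I)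
  let ι : Type := (m : f.support) × (_ : Fin m → OddIndex (p + q)) ×
    {Y : Finset (Fin m) // Y ≠ ∅ ∧ Yᶜ ≠ ∅} × ({1, -1} : Finset ℝ)
  let Φ (i : ι) : FreeAlgebra ℝ (OddIndex (p + q)) :=
    (4⁻¹ * (i.2.2.2 : ℝ) * f.coeff i.1 * β i.1 i.2.1) • (monomial (subword i.2.1 i.2.2.1.1ᶜ) +
      (i.2.2.2 : ℝ) • formalAdjoint (indexSign p q) (monomial (subword i.2.1 i.2.2.1.1ᶜ)))
  let Ψ (i : ι) : FreeAlgebra ℝ (OddIndex (p + q)) :=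
    monomial (subword i.2.1 i.2.2.1.1) +
      (i.2.2.2 : ℝ) • formalAdjoint (indexSign p q) (monomial (subword i.2.1 i.2.2.1.1))
  have hΦ (i : ι) : IsCyclicAdjointUpTo i.2.2.2 (indexSign p q) (Φ i) :=
    isCyclicAdjointUpTo_of_formalAdjoint_eq indexSign_mul_self (by
      simp only [Φ, formalAdjoint_smul, formalAdjoint_add_smul (hss _) indexSign_mul_self]
      rw [smul_comm])
  have hΨ (i : ι) : IsCyclicAdjointUpTo i.2.2.2 (indexSign p q) (Ψ i) :=
    isCyclicAdjointUpTo_of_formalAdjoint_eq indexSign_mul_self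
      (formalAdjoint_add_smul (hss _) indexSign_mul_self _)
  refine ⟨Q + (1 : ℝ) • formalAdjoint (indexSign p q) Q, Fintype.card ι,
    fun i => Φ ((Fintype.equivFin ι).symm i), fun i => Ψ ((Fintype.equivFin ι).symm i),
    isCyclicAdjointUpTo_of_formalAdjoint_eq indexSign_mul_self
      (formalAdjoint_add_smul (one_mul 1) indexSign_mul_self Q), fun i => ?_,
    fun N V _ _ _ S K => ⟨singleTracePoly_eq S K f (fun m I => hβ m I V S) rfl, ?_⟩⟩
  · have h1 := hΦ ((Fintype.equivFin ι).symm i)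
    have h2 := hΨ ((Fintype.equivFin ι).symm i)
    rcases hs ((Fintype.equivFin ι).symm i).2.2.2 with h | h
    · rw [h] at h1 h2
      exact Or.inl ⟨h1, h2⟩
    · rw [h] at h1 h2
      exact Or.inr ⟨h1, h2⟩
  · rw [(Fintype.equivFin ι).symm.sum_comp fun i => traceEval K (Φ i) * traceEval K (Ψ i),
      biTracePoly_eq hd S K f fun m I => hβ m I V S, Fintype.sum_sigma, ← Finset.sum_coe_sort]
    refine Finset.sum_congr rfl fun m _ => ?_
    rw [Fintype.sum_sigma]
    refine Finset.sum_congr rfl fun I _ => ?_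
    rw [Fintype.sum_prod_type, Finset.sum_subtype _ (p := fun Y : Finset (Fin m) =>
      Y ≠ ∅ ∧ Yᶜ ≠ ∅) (by simp)]
    refine Finset.sum_congr rfl fun Y _ => ?_
    rw [← Finset.sum_coe_sort]

end Polynomials

end FuzzyGeom

end

theorem mainTheorem8 (p q : ℕ) (f : Polynomial ℝ) (hf0 : f.coeff 0 = 0)
    (hf : (p + q = 2 ∧ f.natDegree ≤ 6) ∨
      (((p = 0 ∧ q = 4) ∨ (p = 1 ∧ q = 3)) ∧ f.natDegree ≤ 4)) :
    ∃ (P : FreeAlgebra ℝ (FuzzyGeom.OddIndex (p + q))) (n : ℕ)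
      (Φ Ψ : Fin n → FreeAlgebra ℝ (FuzzyGeom.OddIndex (p + q))),
      FuzzyGeom.IsCyclicSelfAdjoint (FuzzyGeom.indexSign p q) P ∧
      (∀ i,
        (FuzzyGeom.IsCyclicSelfAdjoint (FuzzyGeom.indexSign p q) (Φ i) ∧
          FuzzyGeom.IsCyclicSelfAdjoint (FuzzyGeom.indexSign p q) (Ψ i)) ∨
        (FuzzyGeom.IsCyclicAntiSelfAdjoint (FuzzyGeom.indexSign p q) (Φ i) ∧
          FuzzyGeom.IsCyclicAntiSelfAdjoint (FuzzyGeom.indexSign p q) (Ψ i))) ∧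
      ∀ (N : ℕ) (V : Type*) [NormedAddCommGroup V] [InnerProductSpace ℂ V]
        [FiniteDimensional ℂ V] (G : FuzzyGeom.FuzzyGeometry p q N V),
        (∃ K, G.IsParametrizedBy K) ∧
        ∀ K, G.IsParametrizedBy K →
          FuzzyGeom.singleTracePoly G.toSpinorModule K f = FuzzyGeom.traceEval K P ∧
          FuzzyGeom.biTracePoly G.toSpinorModule K f =
            ∑ i, FuzzyGeom.traceEval K (Φ i) * FuzzyGeom.traceEval K (Ψ i) ∧
          G.spectralAction f = (Module.finrank ℂ V : ℂ) *
            ((N : ℂ) * FuzzyGeom.singleTracePoly G.toSpinorModule K f +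
              FuzzyGeom.biTracePoly G.toSpinorModule K f) ∧
          G.spectralAction f = (Module.finrank ℂ V : ℂ) *
            ((N : ℂ) * FuzzyGeom.traceEval K P +
              ∑ i, FuzzyGeom.traceEval K (Φ i) * FuzzyGeom.traceEval K (Ψ i)) := by
  have hd : Even (p + q) := by
    rcases hf with ⟨h, _⟩ | ⟨⟨rfl, rfl⟩ | ⟨rfl, rfl⟩, _⟩
    · exact h ▸ even_two
    · decide
    · decide
  obtain ⟨P, n, Φ, Ψ, hP, hΦΨ, h⟩ := FuzzyGeom.exists_ncPolynomials_of_even hd f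
  refine ⟨P, n, Φ, Ψ, hP, hΦΨ, fun N V _ _ _ G => ⟨G.exists_isParametrizedBy hd, fun K hK => ?_⟩⟩
  obtain ⟨hS, hB⟩ := h N V G.toSpinorModule K
  have hD := G.spectralAction_eq hK hf0
  exact ⟨hS, hB, hD, hS ▸ hB ▸ hD⟩
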